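/- **Setting.** Let $\mathbf k$ be $\mathbb R$ or $\mathbb C$, with $\mathbb R\subset\mathbb C=\mathbb R^2$. A *marked linkage* $\mathcal A$ is a finite graph without loops (multiple edges allowed) with vertex set $\mathcal V$, a positive length $\ell(e)$ for each edge $e$, and a list $(w_1,\dots,w_s)$ of fixed vertices; $Z=(z_1,\dots,z_s)\in\mathbb C^s$ is the image of the marking. The configuration space $C(\mathcal A)\subset\mathbb C^{\mathcal V}$ is the set of maps $\phi:\mathcal V\to\mathbb C$ with $|\phi(v)-\phi(w)|^2=\ell(e)^2$ for each edge $e$ with ends $v,w$, and $\phi(w_i)=z_i$ for all $i$. It is the set of real points of the affine scheme $\mathfrak C(\mathcal A)$ with these equations. For each member $ABC$ of a chosen (possibly empty) set of degenerate triangles, $\ell[AC]=\ell[AB]+\ell[BC]$, the equations of $[AB]$ and $[BC]$ are replaced by the linear equation $\phi(B)=\frac{\ell[BC]}{\ell[AC]}\phi(A)+\frac{\ell[AB]}{\ell[AC]}\phi(C)$. Analytic isomorphisms "in the scheme-theoretic sense" are isomorphisms of the associated, possibly non-reduced, real analytic spaces (as locally ringed spaces). For a group $G$ of homeomorphisms of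 $X$, $Wall(X)$ is the set of points fixed by some nontrivial element of $G$. A map $p:X\to Y$ is a *regular ramified covering with group $G$* if $G$ is finite, $p$ is a topological quotient map whose fibres are exactly the $G$-orbits, and $p$ is a covering over $p(X\setminus Wall(X))$. Let $\mathcal A$ have input vertices $P_1,\dots,P_m$ and output vertices $Q_1,\dots,Q_n$, and let $f:\mathbf k^m\to\mathbf k^n$ and $O\in\mathbf k^m$. Then $\mathcal A$, with a group $Sym(\mathcal A)$ of homeomorphisms of $C(\mathcal A)$ induced by automorphisms of the scheme $\mathfrak C(\mathcal A)$, is a *$\mathbf k$-functional linkage* for the germ $(f,O)$ if: 1. the input map $p(\phi)=(\phi(P_1),\dots,\phi(P_m))$ takes values in $\mathbf k^m$, its image $Dom(\mathcal A)$ has nonempty interior in $\mathbf k^m$, and $p:C(\mathcal A)\to Dom(\mathcal A)$ is a regular ramified covering with group $Sym(\mathcal A)$ whose wall is nowhere dense in $C(\mathcal A)$; 2. $O\in Dom^*(\mathcal A):=p(C^*(\mathcal A))$, where $C^*(\mathcal A)$ is the set of points at which $p$ is a local analytic isomorphism from $\mathfrak C(\mathcal A)$ to $\mathbf k^m$ in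 the scheme-theoretic sense; 3. $\phi(Q_j)=f_j(p(\phi))$ for all $\phi\in C(\mathcal A)$ and all $j$. Given $J\subset\{1,\dots,n\}$ and $\beta:J\to\{1,\dots,s\}$, the *closed functional linkage* $\mathcal L$ is obtained from $\mathcal A$ by identifying the vertex $Q_j$ with the fixed vertex $w_{\beta(j)}$ for each $j\in J$, keeping the edges with their lengths, the chosen degenerate triangles, the marking and $Z$. Thus $C(\mathcal L)\subset C(\mathcal A)$. Its input map $p$ is the restriction of that of $\mathcal A$, $Dom(\mathcal L):=p(C(\mathcal L))$, and $Sym(\mathcal L)$ is the group of restrictions to $C(\mathcal L)$ of the elements of $Sym(\mathcal A)$. **Theorem (3rd functionality theorem).** Suppose that $Dom^*(\mathcal L):=Dom(\mathcal L)\cap Dom^*(\mathcal A)$ is nonempty. Then: (a) $\mathcal L$ is a linkage (it has no loops), and restriction to $C(\mathcal L)$ is a well-defined isomorphism $Sym(\mathcal A)\cong Sym(\mathcal L)$. (b) $p:C(\mathcal L)\to Dom(\mathcal L)$ is a regular ramified covering with group $Sym(\mathcal L)$ of covering transformations. If $Dom^*(\mathcal L)$ is dense in $Dom(\mathcal L)$,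 then its wall is nowhere dense in $C(\mathcal L)$. (c) $Dom^*(\mathcal A)$ is open in $\mathbf k^m$, $f$ is real analytic on it, $Dom^*(\mathcal L)$ is open in $Dom(\mathcal L)$, and $$Dom^*(\mathcal L)=\{x\in Dom^*(\mathcal A): f_j(x)=z_{\beta(j)}\ \text{for all } j\in J\};$$ in particular these two sets are analytically isomorphic. (d) Over $Dom^*(\mathcal L)$ the covering is locally analytically trivial in the scheme-theoretic sense. That is, give $Dom^*(\mathcal L)$ the analytic structure defined by the equations $f_j=z_{\beta(j)}$ on $Dom^*(\mathcal A)$. Then each of its points has a neighbourhood whose preimage in $\mathfrak C(\mathcal L)$ is a disjoint union of open sheets, each mapped isomorphically onto that neighbourhood, and the sheets are permuted simply transitively by $Sym(\mathcal L)$. -/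

import Mathlib

open Set Topology Filter

noncomputable section

/-! Part 1. Real analytic model spaces, possibly non-reduced. -/

section Analytic

variable {E F : Type*} [NormedAddCommGroup E] [NormedSpace ℝ E]
  [NormedAddCommGroup F] [NormedSpace ℝ F]

/-- The ring of germs at `x` of real analytic functions. -/
def analyticGerms (x : E) : Subring (Germ (𝓝 x) ℝ) where
  carrier := {γ | ∃ f : E → ℝ, AnalyticAt ℝ f x ∧ (f : Germ (𝓝 x) ℝ) = γ}
  mul_mem' := by
    rintro _ _ ⟨f, hf, rfl⟩ ⟨g, hg, rfl⟩
    exact ⟨f * g, hf.mul hg, rfl⟩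
  one_mem' := ⟨fun _ => 1, analyticAt_const, rfl⟩
  add_mem' := by
    rintro _ _ ⟨f, hf, rfl⟩ ⟨g, hg, rfl⟩
    exact ⟨f + g, hf.add hg, rfl⟩
  zero_mem' := ⟨fun _ => 0, analyticAt_const, rfl⟩
  neg_mem' := by
    rintro _ ⟨f, hf, rfl⟩
    exact ⟨-f, hf.neg, rfl⟩

/-- The germ at `x` of a function that is analytic at `x`. -/
def analyticGerm {x : E} (f : E → ℝ) (hf : AnalyticAt ℝ f x) : analyticGerms x :=
  ⟨(f : Germ (𝓝 x) ℝ), f, hf, rfl⟩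

/-- A real analytic model space in `E`: the subspace of the open set `dom` cut out by the sheaf of
ideals generated by the analytic functions in `eqs`. Nilpotents are not divided out. -/
structure AnalyticModel (E : Type*) where
  dom : Set E
  eqs : Set (E → ℝ)

namespace AnalyticModel

/-- The underlying set of points. -/
def points (X : AnalyticModel E) : Set E := {x ∈ X.dom | ∀ g ∈ X.eqs, g x = 0}

/-- The stalk at `x` of the ideal sheaf. -/
def idealAt (X : AnalyticModel E) (x : E) : Ideal (analyticGerms x) :=
  Ideal.span {γ | ∃ g ∈ X.eqs, γ.1 = (g : Germ (𝓝 x) ℝ)}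

/-- The local ring at `x` of the structure sheaf. -/
abbrev Stalk (X : AnalyticModel E) (x : E) : Type _ := analyticGerms x ⧸ X.idealAt x

/-- Pull-back along `h` is a well defined isomorphism from the local ring of `Y` at `h x` to the
local ring of `X` at `x`. -/
def IsStalkIso (X : AnalyticModel E) (Y : AnalyticModel F) (h : E → F) (x : E) : Prop :=
  AnalyticAt ℝ h x ∧
  ∃ e : Y.Stalk (h x) ≃+* X.Stalk x,
    ∀ (f : F → ℝ) (hf : AnalyticAt ℝ f (h x)) (hfh : AnalyticAt ℝ (f ∘ h) x),
      e (Ideal.Quotient.mk _ (analyticGerm f hf)) = Ideal.Quotient.mk _ (analyticGerm (f ∘ h) hfh)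

/-- `h` induces an isomorphism of locally ringed spaces from the part of `X` in the open set `U`
onto the part of `Y` in the open set `V`: a homeomorphism of the points and an isomorphism on all
stalks. -/
def IsIsoOn (X : AnalyticModel E) (Y : AnalyticModel F) (h : E → F) (U : Set E) (V : Set F) :
    Prop :=
  IsOpen U ∧ IsOpen V ∧
  (∃ e : ↥(X.points ∩ U) ≃ₜ ↥(Y.points ∩ V), ∀ x, (e x : F) = h x) ∧
  ∀ x ∈ X.points ∩ U, X.IsStalkIso Y h x

/-- `h` is a local analytic isomorphism at `x`, in the scheme-theoretic sense. -/
def IsLocalIsoAt (X : AnalyticModel E) (Y : AnalyticModel F) (h : E → F) (x : E) : Prop :=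
  ∃ (U : Set E) (V : Set F), x ∈ U ∧ h x ∈ V ∧ X.IsIsoOn Y h U V

/-- The whole space, with the sheaf of all analytic functions. -/
def whole (F : Type*) : AnalyticModel F := ⟨univ, ∅⟩

end AnalyticModel

/-- `X` and `Y` are isomorphic as sets with the analytic functions induced from the ambient spaces:
there is a bijection which, together with its inverse, is locally the restriction of an analytic map
of the ambient spaces. -/
def AnalyticallyIsomorphic (X : Set E) (Y : Set F) : Prop :=
  ∃ e : X ≃ Y,
    (∀ x : X, ∃ h : E → F, AnalyticAt ℝ h x ∧ ∀ᶠ u : X in 𝓝 x, (e u : F) = h u) ∧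
    (∀ y : Y, ∃ h : F → E, AnalyticAt ℝ h y ∧ ∀ᶠ u : Y in 𝓝 y, (e.symm u : E) = h u)

end Analytic

/-! Part 2. Regular ramified coverings. -/

section Coverings

variable {X Y : Type*} [TopologicalSpace X] [TopologicalSpace Y]

/-- The points fixed by some nontrivial element of the group. -/
def wall (G : Subgroup (X ≃ₜ X)) : Set X := {x | ∃ g ∈ G, g ≠ 1 ∧ g x = x}

/-- `p` is a regular ramified (branched) covering with group `G` of covering transformations: the
group `G` of homeomorphisms of `X` is finite, `p` is the topological quotient of `X` by `G`, and away
from the wall it is a covering. Where the wall should be small, this is said separately. -/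
structure IsRegularRamifiedCovering (G : Subgroup (X ≃ₜ X)) (p : X → Y) : Prop where
  finite : Finite G
  quotient : IsQuotientMap p
  fiber : ∀ x y, p x = p y ↔ ∃ g ∈ G, g x = y
  covering : IsCoveringMapOn p (p '' (wall G)ᶜ)

end Coverings

section Covering2

variable {E F : Type*} [NormedAddCommGroup E] [NormedSpace ℝ E]
  [NormedAddCommGroup F] [NormedSpace ℝ F]

/-- Let `G` act on `C`, the set of points of `X`. The map `h` is over `Y`, in the scheme-theoretic
sense, a locally analytically trivial covering with group `G`: each point of `Y` has an open
neighbourhood `V` whose preimage in `X` is a disjoint union of open sheets, each of which is mapped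
isomorphically onto the part of `Y` in `V`, and which are permuted simply transitively by `G`. -/
def IsLocallyAnalyticallyTrivialOver (X : AnalyticModel E) (Y : AnalyticModel F) (h : E → F)
    {C : Set E} (G : Subgroup (C ≃ₜ C)) : Prop :=
  ∀ y ∈ Y.points, ∃ V : Set F, IsOpen V ∧ y ∈ V ∧ ∃ S : G → Set E,
    (∀ σ, X.IsIsoOn Y h (S σ) V) ∧
    C ∩ h ⁻¹' V = C ∩ ⋃ σ, S σ ∧
    (∀ σ τ, σ ≠ τ → C ∩ S σ ∩ S τ = ∅) ∧
    (∀ (σ τ : G) (φ : C), (φ : E) ∈ S τ → ((σ : C ≃ₜ C) φ : E) ∈ S (σ * τ))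

end Covering2

/-! Part 3. Linkages and their configuration spaces. -/

/-- A metric graph with vertices `V` and edges `E`. The order of the two ends of an edge plays no
role; multiple edges are allowed. -/
structure MetricGraph (V E : Type*) where
  ends : E → V × V
  len : E → ℝ
  len_pos : ∀ e, 0 < len e

/-- A degenerate triangle: `len AC = len AB + len BC`. -/
structure DegenerateTriangle {V E : Type*} (L : MetricGraph V E) where
  A : V
  B : V
  C : V
  AB : E
  BC : E
  AC : E
  ends_AB : L.ends AB = (A, B) ∨ L.ends AB = (B, A)
  ends_BC : L.ends BC = (B, C) ∨ L.ends BC = (C, B)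
  ends_AC : L.ends AC = (A, C) ∨ L.ends AC = (C, A)
  len_AC : L.len AC = L.len AB + L.len BC

/-- A linkage marked by `s` fixed vertices. `bars` is the (possibly empty) set of those degenerate
triangles `A B C` which are treated as a rigid bar `[AC]` with a hole at `B`. It affects the scheme
structure of the configuration space, but not the set of realizations. -/
structure MarkedLinkage (V E : Type*) (s : ℕ) extends MetricGraph V E where
  mark : Fin s → V
  bars : Set (DegenerateTriangle toMetricGraph)

namespace MarkedLinkage

variable {V E : Type*} {s : ℕ}

/-- No vertex is joined to itself. -/
def Loopless (L : MarkedLinkage V E s) : Prop := ∀ e, (L.ends e).1 ≠ (L.ends e).2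

/-- The relative configuration space `C(L, Z)`: planar realizations `φ` of the metric graph which
send the `i`-th fixed vertex to `Z i`. -/
def config (L : MarkedLinkage V E s) (Z : Fin s → ℂ) : Set (V → ℂ) :=
  {φ | (∀ e, ‖φ (L.ends e).1 - φ (L.ends e).2‖ ^ 2 = L.len e ^ 2) ∧ ∀ i, φ (L.mark i) = Z i}

/-- The real coordinates of a map `V → ℂ`. -/
def coords (φ : V → ℂ) : V × Fin 2 → ℝ := fun i => if i.2 = 0 then (φ i.1).re else (φ i.1).im

/-- The equation `|φ v - φ w|² = ℓ²` of an edge. -/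
def edgeEq (L : MarkedLinkage V E s) (e : E) : MvPolynomial (V × Fin 2) ℝ :=
  (MvPolynomial.X ((L.ends e).1, 0) - MvPolynomial.X ((L.ends e).2, 0)) ^ 2 +
  (MvPolynomial.X ((L.ends e).1, 1) - MvPolynomial.X ((L.ends e).2, 1)) ^ 2 -
  MvPolynomial.C (L.len e ^ 2)

/-- The two real equations `φ(B) = (|BC| / |AC|) φ(A) + (|AB| / |AC|) φ(C)` of a bar. -/
def barEq {L : MetricGraph V E} (t : DegenerateTriangle L) (i : Fin 2) :
    MvPolynomial (V × Fin 2) ℝ :=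
  MvPolynomial.X (t.B, i) - MvPolynomial.C (L.len t.BC / L.len t.AC) * MvPolynomial.X (t.A, i) -
    MvPolynomial.C (L.len t.AB / L.len t.AC) * MvPolynomial.X (t.C, i)

/-- The two real equations `φ(w) = z` of a fixed vertex. -/
def markEq (L : MarkedLinkage V E s) (Z : Fin s → ℂ) (i : Fin s) (k : Fin 2) :
    MvPolynomial (V × Fin 2) ℝ :=
  MvPolynomial.X (L.mark i, k) - MvPolynomial.C (if k = 0 then (Z i).re else (Z i).im)

/-- All the defining equations of the configuration scheme: those of the bars, replacing the
equations of their short edges, those of the remaining edges, and those of the fixed vertices. -/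
def schemeEqs (L : MarkedLinkage V E s) (Z : Fin s → ℂ) : Set (MvPolynomial (V × Fin 2) ℝ) :=
  {g | ∃ e, (∀ t ∈ L.bars, e ≠ t.AB ∧ e ≠ t.BC) ∧ g = L.edgeEq e} ∪
  {g | ∃ t ∈ L.bars, ∃ i, g = barEq t i} ∪
  {g | ∃ i k, g = L.markEq Z i k}

/-- The ideal of the configuration scheme. -/
def schemeIdeal (L : MarkedLinkage V E s) (Z : Fin s → ℂ) : Ideal (MvPolynomial (V × Fin 2) ℝ) :=
  Ideal.span (L.schemeEqs Z)

/-- The real analytic space of the configuration scheme. -/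
def analyticSpace (L : MarkedLinkage V E s) (Z : Fin s → ℂ) : AnalyticModel (V → ℂ) where
  dom := univ
  eqs := {h | ∃ g ∈ L.schemeEqs Z, h = fun φ => MvPolynomial.eval (coords φ) g}

/-- A self-homeomorphism of `C(L, Z)` which is induced by an automorphism of the configuration
scheme, that is, by an automorphism `α` of its coordinate ring. -/
def IsSchemeAutomorphism (L : MarkedLinkage V E s) (Z : Fin s → ℂ)
    (σ : L.config Z ≃ₜ L.config Z) : Prop :=
  ∃ α : (MvPolynomial (V × Fin 2) ℝ ⧸ L.schemeIdeal Z) ≃ₐ[ℝ]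
      (MvPolynomial (V × Fin 2) ℝ ⧸ L.schemeIdeal Z),
    ∀ g g' : MvPolynomial (V × Fin 2) ℝ,
      α (Ideal.Quotient.mk _ g) = Ideal.Quotient.mk _ g' →
      ∀ φ : L.config Z, MvPolynomial.eval (coords (σ φ : V → ℂ)) g =
        MvPolynomial.eval (coords (φ : V → ℂ)) g'

end MarkedLinkage

/-! Part 4. Functional linkages. -/

section Functional

variable (𝕜 : Type*) [RCLike 𝕜]

/-- The standard embedding in `ℂ` of `𝕜`, which is `ℝ` or `ℂ`. -/
def planeOf (x : 𝕜) : ℂ := ⟨RCLike.re x, RCLike.im x⟩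

/-- The standard retraction of `ℂ` to `𝕜`; if `𝕜` is `ℝ` it is the real part. -/
def ofPlane (z : ℂ) : 𝕜 := (z.re : 𝕜) + (z.im : 𝕜) * RCLike.I

/-- The input map `φ ↦ (φ(P₁), …, φ(Pₘ))`, with values read in `𝕜`. -/
def inputMap {V : Type*} {m : ℕ} (P : Fin m → V) (φ : V → ℂ) : Fin m → 𝕜 :=
  fun j => ofPlane 𝕜 (φ (P j))

variable {V E : Type*} {s m n : ℕ} (L : MarkedLinkage V E s) (Z : Fin s → ℂ) (P : Fin m → V)

/-- The domain: the image of the input map. -/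
def inputDom : Set (Fin m → 𝕜) := inputMap 𝕜 P '' L.config Z

/-- The input map from the configuration space onto the domain. -/
def inputToDom (φ : L.config Z) : inputDom 𝕜 L Z P := ⟨inputMap 𝕜 P φ, φ, φ.2, rfl⟩

/-- `C*(L, Z)`: the realizations at which the input map is a local analytic isomorphism to `𝕜ᵐ` in
the scheme-theoretic sense. -/
def configStar [Fintype V] : Set (V → ℂ) :=
  {φ ∈ L.config Z |
    (L.analyticSpace Z).IsLocalIsoAt (AnalyticModel.whole (Fin m → 𝕜)) (inputMap 𝕜 P) φ}

/-- `Dom*(L, Z)`: the image of `C*(L, Z)`. -/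
def domStar [Fintype V] : Set (Fin m → 𝕜) := inputMap 𝕜 P '' configStar 𝕜 L Z P

/-- `L`, with image of marking `Z`, input vertices `P`, output vertices `Q` and symmetry group `Sym`,
is a `𝕜`-functional linkage for the germ `(f, O)`. -/
structure IsFunctionalLinkage {𝕜} [RCLike 𝕜] [Fintype V] (L : MarkedLinkage V E s)
    (Z : Fin s → ℂ) (P : Fin m → V) (Q : Fin n → V) (Sym : Subgroup (L.config Z ≃ₜ L.config Z))
    (f : (Fin m → 𝕜) → (Fin n → 𝕜)) (O : Fin m → 𝕜) : Prop where
  loopless : L.Loopless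
  input_mem : ∀ φ ∈ L.config Z, ∀ j, planeOf 𝕜 (inputMap 𝕜 P φ j) = φ (P j)
  isDomain : (interior (inputDom 𝕜 L Z P)).Nonempty
  covering : IsRegularRamifiedCovering Sym (inputToDom 𝕜 L Z P)
  wall_nowhereDense : IsNowhereDense (wall Sym)
  schemeAutomorphism : ∀ σ ∈ Sym, L.IsSchemeAutomorphism Z σ
  base_mem : O ∈ domStar 𝕜 L Z P
  output : ∀ φ ∈ L.config Z, ∀ j, φ (Q j) = planeOf 𝕜 (f (inputMap 𝕜 P φ) j)

end Functional

/-! Part 5. Closed functional linkages. -/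

section Closed

variable {V E : Type*} {s n : ℕ}

/-- The vertices after the output vertices `Q j`, for `j ∈ J`, have been identified with the fixed
vertices `mark (β j)`. -/
def GluedVertex (mark : Fin s → V) (Q : Fin n → V) (J : Set (Fin n)) (β : J → Fin s) : Type _ :=
  Quot fun a b : V => ∃ j : J, a = Q j ∧ b = mark (β j)

/-- The projection to the glued vertices. -/
def glue (mark : Fin s → V) (Q : Fin n → V) (J : Set (Fin n)) (β : J → Fin s) (v : V) :
    GluedVertex mark Q J β := Quot.mk _ v

instance [Finite V] (mark : Fin s → V) (Q : Fin n → V) (J : Set (Fin n)) (β : J → Fin s) :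
    Finite (GluedVertex mark Q J β) := inferInstanceAs (Finite (Quot _))

instance [Fintype V] (mark : Fin s → V) (Q : Fin n → V) (J : Set (Fin n)) (β : J → Fin s) :
    Fintype (GluedVertex mark Q J β) := Fintype.ofFinite _

/-- The metric graph obtained by identifying vertices along a map `π`. -/
def MetricGraph.map {V' : Type*} (L : MetricGraph V E) (π : V → V') : MetricGraph V' E where
  ends e := (π (L.ends e).1, π (L.ends e).2)
  len := L.len
  len_pos := L.len_pos

/-- The image of a degenerate triangle. -/
def DegenerateTriangle.map {V' : Type*} {L : MetricGraph V E} (t : DegenerateTriangle L)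
    (π : V → V') : DegenerateTriangle (L.map π) where
  A := π t.A
  B := π t.B
  C := π t.C
  AB := t.AB
  BC := t.BC
  AC := t.AC
  ends_AB := by rcases t.ends_AB with h | h <;> simp [MetricGraph.map, h]
  ends_BC := by rcases t.ends_BC with h | h <;> simp [MetricGraph.map, h]
  ends_AC := by rcases t.ends_AC with h | h <;> simp [MetricGraph.map, h]
  len_AC := t.len_AC

/-- The input vertices after the identification. -/
def gluedInput {m : ℕ} (mark : Fin s → V) (Q : Fin n → V) (J : Set (Fin n)) (β : J → Fin s)
    (P : Fin m → V) : Fin m → GluedVertex mark Q J β := fun j => glue mark Q J β (P j)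

namespace MarkedLinkage

/-- The self-fiber sum of `L` along the identification `Q j ↦ mark (β j)`. -/
def selfFiberSum (L : MarkedLinkage V E s) (Q : Fin n → V) (J : Set (Fin n)) (β : J → Fin s) :
    MarkedLinkage (GluedVertex L.mark Q J β) E s where
  toMetricGraph := L.toMetricGraph.map (glue L.mark Q J β)
  mark i := glue L.mark Q J β (L.mark i)
  bars := (fun t => t.map (glue L.mark Q J β)) '' L.bars

/-- A realization of the self-fiber sum, regarded as a realization of the original linkage. -/
def unglue (L : MarkedLinkage V E s) (Z : Fin s → ℂ) (Q : Fin n → V) (J : Set (Fin n))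
    (β : J → Fin s) (φ : (L.selfFiberSum Q J β).config Z) : L.config Z :=
  ⟨fun v => (φ : GluedVertex L.mark Q J β → ℂ) (glue L.mark Q J β v),
    fun e => φ.2.1 e, fun i => φ.2.2 i⟩

/-- The symmetry group of the closed linkage: the homeomorphisms of its configuration space which are
restrictions of elements of the symmetry group of the original linkage. -/
def closedSym (L : MarkedLinkage V E s) (Z : Fin s → ℂ) (Q : Fin n → V) (J : Set (Fin n))
    (β : J → Fin s) (Sym : Subgroup (L.config Z ≃ₜ L.config Z)) :
    Subgroup ((L.selfFiberSum Q J β).config Z ≃ₜ (L.selfFiberSum Q J β).config Z) where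
  carrier := {h | ∃ σ ∈ Sym, ∀ φ, L.unglue Z Q J β (h φ) = σ (L.unglue Z Q J β φ)}
  mul_mem' := by
    rintro a b ⟨σ, hσ, ha⟩ ⟨τ, hτ, hb⟩
    exact ⟨σ * τ, Sym.mul_mem hσ hτ, fun φ => by
      simp only [Homeomorph.mul_apply, ha, hb]⟩
  one_mem' := ⟨1, Sym.one_mem, fun _ => rfl⟩
  inv_mem' := by
    rintro a ⟨σ, hσ, ha⟩
    refine ⟨σ⁻¹, Sym.inv_mem hσ, fun φ => ?_⟩
    have h := ha (a⁻¹ φ)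
    have h1 : a (a⁻¹ φ) = φ := a.apply_symm_apply φ
    rw [h1] at h
    rw [h]
    exact (σ.symm_apply_apply _).symm

end MarkedLinkage

/-- The analytic space `{x ∈ D : f_j(x) = z_{β(j)}, j ∈ J}`, with the structure sheaf given by these
equations. -/
def levelSpace {𝕜 : Type*} [RCLike 𝕜] {m : ℕ} (D : Set (Fin m → 𝕜))
    (f : (Fin m → 𝕜) → (Fin n → 𝕜)) (Z : Fin s → ℂ) (J : Set (Fin n)) (β : J → Fin s) :
    AnalyticModel (Fin m → 𝕜) where
  dom := D
  eqs := {h | ∃ j : J, (h = fun x => (planeOf 𝕜 (f x j) - Z (β j)).re) ∨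
    (h = fun x => (planeOf 𝕜 (f x j) - Z (β j)).im)}

end Closed

end

/-! Closing the linkage imposes `φ (Q j) = Z (β j)`. Since `φ (Q j)` is the `j`-th component of `f`
at the input of `φ`, this is a condition on the input alone. So the realizations of the closed
linkage form a closed subset of `C(A)`, saturated for the input map `p` and stable under `Sym`. The
topology follows: the quotient map by a finite group is closed, so it restricts to a quotient map,
and a finite group acting on a Hausdorff space gives a covering off its wall. Moreover `Sym` acts
freely over `Dom*(A)`: there `p` is injective near each point of the fibre, so a nontrivial symmetry
fixing such a point would be the identity near it, and the wall would have interior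
(`eq_one_of_fixed`). Hence restriction to the closed linkage loses no symmetry.

For the scheme structure, a local isomorphism `p` to the smooth space `𝕜ᵐ` has an analytic section
`g`, and `C(A)` is reduced there (`IsAnalyticSection`). Scheme automorphisms carry this property
from a point of `C*` to its whole fibre. Reducedness promotes the pointwise output identity to one
in the local rings, so the equations added by gluing become exactly `f_j = z_{β(j)}` on `𝕜ᵐ`
(`isStalkIso_selfFiberSum`).

The recurring technical point is that maps agree only modulo an ideal of germs. Hadamard's lemma
shows that composing them with an analytic function preserves the congruence
(`GermMem.comp_sub_comp`). -/

open Set Topology Filter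

noncomputable section

/-! ### Divided differences of power series and Hadamard's lemma -/

section DividedDifference

variable {E F : Type*} [NormedAddCommGroup E] [NormedSpace ℝ E]
  [NormedAddCommGroup F] [NormedSpace ℝ F]

/-- The multilinear map `pₙ₊₁(u, …, u, ·, v, …, v)` in the pairs `(u, v)`, with the slot at `k`. -/
def FormalMultilinearSeries.dividedDifferenceTerm (p : FormalMultilinearSeries ℝ E F) (n : ℕ)
    (k : Fin (n + 1)) : E × E [×n]→L[ℝ] E →L[ℝ] F :=
  ContinuousMultilinearMap.compContinuousLinearMap
    (ContinuousLinearMap.flipMultilinear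
      (ContinuousMultilinearMap.curryMid (Ei := fun _ => E) k (p (n + 1))))
    (fun i : Fin n => if (i : ℕ) < k then ContinuousLinearMap.fst ℝ E E
      else ContinuousLinearMap.snd ℝ E E)

/-- The power series of the divided difference of the sum of a power series. -/
def FormalMultilinearSeries.dividedDifference (p : FormalMultilinearSeries ℝ E F) :
    FormalMultilinearSeries ℝ (E × E) (E →L[ℝ] F) := fun n => ∑ k, p.dividedDifferenceTerm n k

/-- Replacing `v` by `u` one slot at a time gives a telescoping sum; the term with index `k` is the
change caused by slot `k`. -/
theorem FormalMultilinearSeries.dividedDifference_apply (p : FormalMultilinearSeries ℝ E F)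
    (n : ℕ) (u v : E) :
    p.dividedDifference n (fun _ => (u, v)) (u - v) =
      p (n + 1) (fun _ => u) - p (n + 1) (fun _ => v) := by
  set M : ℕ → Fin (n + 1) → E := fun k i => if (i : ℕ) < k then u else v with hM
  have key : ∀ k : Fin (n + 1),
      p.dividedDifferenceTerm n k (fun _ => (u, v)) (u - v) =
      p (n + 1) (M (k + 1)) - p (n + 1) (M k) := by
    intro k
    rw [dividedDifferenceTerm, ContinuousMultilinearMap.compContinuousLinearMap_apply,
      ContinuousLinearMap.flipMultilinear_apply_apply, map_sub]
    have hins : ∀ (x : E) (j : ℕ), (∀ i : Fin (n + 1), M j i = if i = k then x else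
        if (i : ℕ) < k then u else v) →
        (k.insertNth x fun i : Fin n => (if (i : ℕ) < k then ContinuousLinearMap.fst ℝ E E
          else ContinuousLinearMap.snd ℝ E E) (u, v) : Fin (n + 1) → E) = M j := by
      intro x j hj
      funext i
      rw [hj]
      refine Fin.succAboveCases k ?_ (fun i => ?_) i
      · simp
      · rw [Fin.insertNth_apply_succAbove, if_neg (Fin.succAbove_ne k i)]
        by_cases h : (i : ℕ) < k
        · have : k.succAbove i = i.castSucc := Fin.succAbove_of_castSucc_lt _ _ h
          simp [h, this]
        · have : k.succAbove i = i.succ := Fin.succAbove_of_le_castSucc _ _ (not_lt.1 h)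
          simp only [this, Fin.val_succ, if_neg h]
          rw [if_neg (by omega)]
          rfl
    rw [_root_.sub_apply, ContinuousMultilinearMap.curryMid_apply,
      ContinuousMultilinearMap.curryMid_apply, hins u (k + 1), hins v k]
    · intro i
      simp only [hM]
      by_cases h : i = k
      · simp [h]
      · simp [h]
    · intro i
      simp only [hM]
      by_cases h : i = k
      · simp [h]
      · have : (i : ℕ) ≠ k := fun h' => h (Fin.ext h')
        simp only [h, if_false]
        congr 1
        simp only [eq_iff_iff]
        omega
  rw [FormalMultilinearSeries.dividedDifference, sum_apply, sum_apply, Finset.sum_congr rfl fun k _ => key k,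
    Fin.sum_univ_eq_sum_range (fun k => p (n + 1) (M (k + 1)) - p (n + 1) (M k)) (n + 1),
    ]
  refine (Finset.sum_range_sub (fun k => p (n + 1) (M k)) (n + 1)).trans ?_
  congr 2
  funext i
  simp only [hM, i.2, if_true]

theorem FormalMultilinearSeries.norm_dividedDifferenceTerm_le (p : FormalMultilinearSeries ℝ E F)
    (n : ℕ) (k : Fin (n + 1)) : ‖p.dividedDifferenceTerm n k‖ ≤ ‖p (n + 1)‖ := by
  refine (ContinuousMultilinearMap.norm_compContinuousLinearMap_le _ _).trans ?_
  have h1 : ‖ContinuousLinearMap.flipMultilinear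
        (ContinuousMultilinearMap.curryMid (Ei := fun _ => E) k (p (n + 1)))‖ ≤ ‖p (n + 1)‖ := by
    refine (MultilinearMap.mkContinuous_norm_le _ (norm_nonneg _) _).trans ?_
    rw [ContinuousMultilinearMap.norm_curryMid]
  have h2 : ∏ i : Fin n, ‖(if (i : ℕ) < k then ContinuousLinearMap.fst ℝ E E
        else ContinuousLinearMap.snd ℝ E E)‖ ≤ 1 := by
    refine Finset.prod_le_one (fun _ _ => norm_nonneg _) fun i _ => ?_
    split_ifs
    · exact ContinuousLinearMap.norm_fst_le ..
    · exact ContinuousLinearMap.norm_snd_le ..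
  calc _ ≤ ‖p (n + 1)‖ * 1 := mul_le_mul h1 h2
        (Finset.prod_nonneg fun _ _ => norm_nonneg _) (norm_nonneg _)
    _ = _ := mul_one _

theorem FormalMultilinearSeries.norm_dividedDifference_le (p : FormalMultilinearSeries ℝ E F)
    (n : ℕ) : ‖p.dividedDifference n‖ ≤ (n + 1) * ‖p (n + 1)‖ := by
  have h : ‖p.dividedDifference n‖ ≤ ∑ k, ‖p.dividedDifferenceTerm n k‖ :=
    norm_sum_le Finset.univ (p.dividedDifferenceTerm n)
  refine h.trans ((Finset.sum_le_sum fun k _ => p.norm_dividedDifferenceTerm_le n k).trans ?_)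
  simp

/-- The number `n + 1` of terms is at most `2 ^ n`, so halving the radius absorbs it. The shift of
degree accounts for the bound `C / r`. -/
theorem FormalMultilinearSeries.dividedDifference_radius_pos {p : FormalMultilinearSeries ℝ E F}
    (hp : 0 < p.radius) : 0 < p.dividedDifference.radius := by
  obtain ⟨r, hr0, hr⟩ := ENNReal.lt_iff_exists_nnreal_btwn.1 hp
  have hr0' : 0 < r := by exact_mod_cast hr0
  obtain ⟨C, hC, hb⟩ := p.norm_mul_pow_le_of_lt_radius hr
  have hrR : (0 : ℝ) < r := hr0'
  refine lt_of_lt_of_le (b := ((r / 2 : NNReal) : ENNReal)) ?_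
    (p.dividedDifference.le_radius_of_bound (C / r) (r := r / 2) fun n => ?_)
  · exact_mod_cast half_pos hr0'
  · have h2 : ((n : ℝ) + 1) ≤ 2 ^ n := by exact_mod_cast Nat.lt_two_pow_self (n := n)
    calc ‖p.dividedDifference n‖ * ((r / 2 : NNReal) : ℝ) ^ n
        ≤ ((n + 1) * ‖p (n + 1)‖) * ((r / 2 : NNReal) : ℝ) ^ n := by
          gcongr
          exact p.norm_dividedDifference_le n
      _ = ((n + 1) / 2 ^ n) * (‖p (n + 1)‖ * r ^ (n + 1)) / r := by
          push_cast
          have : ((1 : ℝ) / 2) ^ n * 2 ^ n = 1 := by rw [← mul_pow]; norm_num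
          field_simp
          linear_combination (‖p (n + 1)‖ * r ^ (n + 1)) * this
      _ ≤ 1 * C / r := by
          gcongr
          · exact (div_le_one (by positivity)).2 h2
          · exact hb (n + 1)
      _ = C / r := by rw [one_mul]

/-- **Hadamard's lemma** for real analytic functions. -/
theorem AnalyticAt.exists_sub_eq [CompleteSpace F] {f : E → F} {x : E} (hf : AnalyticAt ℝ f x) :
    ∃ G : E × E → E →L[ℝ] F, AnalyticAt ℝ G (x, x) ∧
      ∀ᶠ z in 𝓝 (x, x), f z.1 - f z.2 = G z (z.1 - z.2) := by
  obtain ⟨p, r, hp⟩ := hf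
  have hpos := FormalMultilinearSeries.dividedDifference_radius_pos (hp.r_pos.trans_le hp.r_le)
  set q := p.dividedDifference with hq
  have hqs := q.hasFPowerSeriesOnBall hpos
  refine ⟨fun z => q.sum (z - (x, x)), ?_, ?_⟩
  · have h := hqs.comp_sub (x, x)
    rw [zero_add] at h
    exact h.analyticAt
  · have h1 : ∀ᶠ z : E × E in 𝓝 (x, x), z - (x, x) ∈ Metric.eball (0 : E × E) q.radius := by
      have : Tendsto (fun z : E × E => z - (x, x)) (𝓝 (x, x)) (𝓝 0) := by
        have : ContinuousAt (fun z : E × E => z - (x, x)) (x, x) := by fun_prop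
        simpa [ContinuousAt] using this
      exact this (Metric.eball_mem_nhds _ hpos)
    have h2 : ∀ᶠ z : E × E in 𝓝 (x, x), z.1 - x ∈ Metric.eball (0 : E) r ∧
        z.2 - x ∈ Metric.eball (0 : E) r := by
      have t1 : Tendsto (fun z : E × E => z.1 - x) (𝓝 (x, x)) (𝓝 0) := by
        have : ContinuousAt (fun z : E × E => z.1 - x) (x, x) := by fun_prop
        simpa [ContinuousAt] using this
      have t2 : Tendsto (fun z : E × E => z.2 - x) (𝓝 (x, x)) (𝓝 0) := by
        have : ContinuousAt (fun z : E × E => z.2 - x) (x, x) := by fun_prop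
        simpa [ContinuousAt] using this
      exact (t1.eventually (Metric.eball_mem_nhds _ hp.r_pos)).and
        (t2.eventually (Metric.eball_mem_nhds _ hp.r_pos))
    filter_upwards [h1, h2] with z hz1 hz2
    have s1 := hp.hasSum hz2.1
    have s2 := hp.hasSum hz2.2
    have s3 := s1.sub s2
    -- The terms of degree `0` cancel in the difference. Dropping them matches `p (n + 1)` with `q
    -- n`.
    rw [add_sub_cancel, add_sub_cancel, ← hasSum_nat_add_iff' 1] at s3
    have s4 := (ContinuousLinearMap.apply ℝ F (z.1 - z.2)).hasSum (hqs.hasSum hz1)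
    rw [zero_add] at s4
    refine HasSum.unique ?_ s4
    convert s3 using 1
    · funext n
      have := p.dividedDifference_apply n (z.1 - x) (z.2 - x)
      rw [sub_sub_sub_cancel_right] at this
      exact this
    · have : p 0 (fun _ => z.1 - x) = p 0 (fun _ => z.2 - x) :=
        congrArg _ (Subsingleton.elim _ _)
      simp [this]

end DividedDifference

/-! ### Ideals of analytic germs, maps of stalks and analytic sections -/

section GermIdeals

variable {E F : Type*} [NormedAddCommGroup E] [NormedSpace ℝ E]
  [NormedAddCommGroup F] [NormedSpace ℝ F]

theorem analyticAt_of_mem_analyticGerms {x : E} {f : E → ℝ} {γ : analyticGerms x}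
    (h : γ.1 = (f : Germ (𝓝 x) ℝ)) : AnalyticAt ℝ f x := by
  obtain ⟨γ, f', hf', rfl⟩ := γ
  exact hf'.congr (Germ.coe_eq.1 h)

/-- The germ of `f` at `x` is analytic and lies in the ideal `I`. -/
def GermMem {x : E} (I : Ideal (analyticGerms x)) (f : E → ℝ) : Prop :=
  ∃ γ ∈ I, γ.1 = (f : Germ (𝓝 x) ℝ)

namespace GermMem

variable {x : E} {I : Ideal (analyticGerms x)} {f g : E → ℝ}

theorem analyticAt (h : GermMem I f) : AnalyticAt ℝ f x :=
  let ⟨_, _, h⟩ := h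
  analyticAt_of_mem_analyticGerms h

theorem analyticGerm_mem (h : GermMem I f) (hf : AnalyticAt ℝ f x) : analyticGerm f hf ∈ I := by
  obtain ⟨γ, hγ, h⟩ := h
  have : analyticGerm f hf = γ := Subtype.ext h.symm
  rwa [this]

theorem of_analyticGerm_mem {hf : AnalyticAt ℝ f x} (h : analyticGerm f hf ∈ I) : GermMem I f :=
  ⟨_, h, rfl⟩

theorem congr (h : GermMem I f) (hfg : f =ᶠ[𝓝 x] g) : GermMem I g :=
  let ⟨γ, hγ, h⟩ := h
  ⟨γ, hγ, h.trans (Germ.coe_eq.2 hfg)⟩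

theorem of_eventuallyEq_zero (h : ∀ᶠ z in 𝓝 x, f z = 0) : GermMem I f :=
  ⟨0, I.zero_mem, Germ.coe_eq.2 (h.mono fun _ hz => hz.symm)⟩

theorem add (hf : GermMem I f) (hg : GermMem I g) : GermMem I (fun z => f z + g z) := by
  obtain ⟨γ, hγ, h⟩ := hf
  obtain ⟨δ, hδ, h'⟩ := hg
  refine ⟨γ + δ, I.add_mem hγ hδ, ?_⟩
  rw [Subring.coe_add, h, h']
  rfl

theorem mul_left (hf : GermMem I f) (hg : AnalyticAt ℝ g x) :
    GermMem I (fun z => g z * f z) := by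
  obtain ⟨γ, hγ, h⟩ := hf
  refine ⟨analyticGerm g hg * γ, I.mul_mem_left _ hγ, ?_⟩
  rw [Subring.coe_mul, h]
  rfl

theorem const_mul (hf : GermMem I f) (c : ℝ) : GermMem I (fun z => c * f z) :=
  hf.mul_left analyticAt_const

theorem neg (hf : GermMem I f) : GermMem I (fun z => -f z) := by
  simpa using hf.const_mul (-1)

theorem sub (hf : GermMem I f) (hg : GermMem I g) : GermMem I (fun z => f z - g z) := by
  simpa [sub_eq_add_neg] using hf.add hg.neg

theorem sum {ι : Type*} {s : Finset ι} {f : ι → E → ℝ} (h : ∀ i ∈ s, GermMem I (f i)) :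
    GermMem I (fun z => ∑ i ∈ s, f i z) := by
  classical
  induction s using Finset.induction_on with
  | empty => exact of_eventuallyEq_zero (by simp)
  | insert i s hi ih =>
    simp only [Finset.sum_insert hi]
    exact (h i (by simp)).add (ih fun j hj => h j (by simp [hj]))

/-- An analytic function takes congruent values at points with congruent coordinates. -/
theorem comp_sub_comp [FiniteDimensional ℝ F] {u : F → ℝ} {y : F} (hu : AnalyticAt ℝ u y)
    {r s : E → F} (hr : AnalyticAt ℝ r x) (hs : AnalyticAt ℝ s x) (hrx : r x = y) (hsx : s x = y)
    (h : ∀ l : F →L[ℝ] ℝ, GermMem I (fun z => l (r z) - l (s z))) :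
    GermMem I (fun z => u (r z) - u (s z)) := by
  -- By Hadamard's lemma the difference is `G (r, s) (r - s)`. In a finite basis this is a finite
  -- combination of the coordinates of `r - s` with analytic coefficients.
  obtain ⟨G, hG, hGu⟩ := hu.exists_sub_eq
  have hrs : AnalyticAt ℝ (fun z => (r z, s z)) x := hr.prod hs
  have hG' : AnalyticAt ℝ (fun z => G (r z, s z)) x := by
    refine AnalyticAt.fun_comp (g := G) ?_ hrs
    rwa [hrx, hsx]
  let b := Module.finBasis ℝ F
  have key : GermMem I (fun z => ∑ i, G (r z, s z) (b i) *
      ((b.coord i).toContinuousLinearMap (r z) - (b.coord i).toContinuousLinearMap (s z))) :=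
    sum fun i _ => (h _).mul_left
      ((ContinuousLinearMap.apply ℝ ℝ (b i)).analyticAt _ |>.fun_comp hG')
  refine key.congr ?_
  have ht : Tendsto (fun z => (r z, s z)) (𝓝 x) (𝓝 (y, y)) := by
    have := hrs.continuousAt
    rwa [ContinuousAt, hrx, hsx] at this
  filter_upwards [ht.eventually hGu] with z hz
  rw [hz]
  conv_rhs => rw [← b.sum_repr (r z - s z)]
  rw [map_sum]
  refine Finset.sum_congr rfl fun i _ => ?_
  simp [mul_comm]

end GermMem

/-- Pull-back of germs of analytic functions. -/
def analyticGermsPull {x : E} {y : F} (r : E → F) (hr : AnalyticAt ℝ r x) (hx : r x = y) :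
    analyticGerms y →+* analyticGerms x where
  toFun γ := ⟨γ.1.compTendsto r (by have := hr.continuousAt; rwa [ContinuousAt, hx] at this), by
    obtain ⟨_, f, hf, rfl⟩ := γ
    subst hx
    exact ⟨f ∘ r, hf.comp hr, rfl⟩⟩
  map_one' := rfl
  map_zero' := rfl
  map_mul' := by
    rintro ⟨_, f, hf, rfl⟩ ⟨_, g, hg, rfl⟩
    rfl
  map_add' := by
    rintro ⟨_, f, hf, rfl⟩ ⟨_, g, hg, rfl⟩
    rfl

theorem analyticGermsPull_val {x : E} {y : F} {r : E → F} (hr : AnalyticAt ℝ r x) (hx : r x = y)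
    {γ : analyticGerms y} {g : F → ℝ} (h : γ.1 = (g : Germ (𝓝 y) ℝ)) :
    (analyticGermsPull r hr hx γ).1 = ((g ∘ r : E → ℝ) : Germ (𝓝 x) ℝ) := by
  obtain ⟨_, _⟩ := γ
  subst h
  rfl

namespace AnalyticModel

variable {X : AnalyticModel E} {Y : AnalyticModel F}

theorem germMem_of_mem_eqs {x : E} {g : E → ℝ} (hg : g ∈ X.eqs) (hgx : AnalyticAt ℝ g x) :
    GermMem (X.idealAt x) g :=
  ⟨analyticGerm g hgx, Ideal.subset_span ⟨g, hg, rfl⟩, rfl⟩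

theorem idealAt_le_comap {x : E} {y : F} {r : E → F} (hr : AnalyticAt ℝ r x) (hx : r x = y)
    {I : Ideal (analyticGerms x)} (h : ∀ g ∈ Y.eqs, AnalyticAt ℝ g y → GermMem I (g ∘ r)) :
    Y.idealAt y ≤ I.comap (analyticGermsPull r hr hx) := by
  rw [idealAt, Ideal.span_le]
  rintro γ ⟨g, hg, hγ⟩
  have hgy := analyticAt_of_mem_analyticGerms hγ
  obtain ⟨δ, hδ, h'⟩ := h g hg hgy
  have : analyticGermsPull r hr hx γ = δ := by
    apply Subtype.ext
    rw [h', analyticGermsPull_val hr hx hγ]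
  rw [SetLike.mem_coe, Ideal.mem_comap, this]
  exact hδ

theorem germMem_comp {x : E} {y : F} {r : E → F} (hr : AnalyticAt ℝ r x) (hx : r x = y)
    {I : Ideal (analyticGerms x)} (h : ∀ g ∈ Y.eqs, AnalyticAt ℝ g y → GermMem I (g ∘ r))
    {u : F → ℝ} (hu : GermMem (Y.idealAt y) u) : GermMem I (fun z => u (r z)) := by
  obtain ⟨γ, hγ, h'⟩ := hu
  exact ⟨_, idealAt_le_comap hr hx h hγ, analyticGermsPull_val hr hx h'⟩

/-- The converse can fail at a non-reduced point; where it is needed, the field `germMem` of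
`IsAnalyticSection` supplies it. -/
theorem eventually_eq_zero_of_germMem {x : E} {f : E → ℝ} (h : GermMem (X.idealAt x) f) :
    ∀ᶠ z in 𝓝 x, z ∈ X.points → f z = 0 := by
  obtain ⟨γ, hγ, hf⟩ := h
  have key : ∃ f : E → ℝ, γ.1 = (f : Germ (𝓝 x) ℝ) ∧ ∀ᶠ z in 𝓝 x, z ∈ X.points → f z = 0 := by
    refine Submodule.span_induction (p := fun γ _ => ∃ f : E → ℝ, γ.1 = (f : Germ (𝓝 x) ℝ) ∧
      ∀ᶠ z in 𝓝 x, z ∈ X.points → f z = 0) ?_ ?_ ?_ ?_ hγ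
    · rintro γ ⟨g, hg, hγ⟩
      exact ⟨g, hγ, Eventually.of_forall fun z hz => hz.2 g hg⟩
    · exact ⟨fun _ => 0, rfl, by simp⟩
    · rintro γ δ - - ⟨f, hf, hf'⟩ ⟨g, hg, hg'⟩
      refine ⟨fun z => f z + g z, ?_, ?_⟩
      · rw [Subring.coe_add, hf, hg]
        rfl
      · filter_upwards [hf', hg'] with z h1 h2 hz
        rw [h1 hz, h2 hz, add_zero]
    · rintro ⟨_, g, hg, rfl⟩ δ - ⟨f, hf, hf'⟩
      refine ⟨fun z => g z * f z, ?_, ?_⟩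
      · rw [smul_eq_mul, Subring.coe_mul, hf]
        rfl
      · filter_upwards [hf'] with z h1 hz
        rw [h1 hz, mul_zero]
  obtain ⟨g, hg, hg'⟩ := key
  filter_upwards [hg', Germ.coe_eq.1 (hg.symm.trans hf)] with z h1 h2 hz
  rw [← h2, h1 hz]

/-- A criterion for pull-back along `h` to be an isomorphism on stalks. -/
theorem isStalkIso_of_pull {h : E → F} {x : E} (hh : AnalyticAt ℝ h x)
    (hwd : ∀ g ∈ Y.eqs, AnalyticAt ℝ g (h x) → GermMem (X.idealAt x) (g ∘ h))
    (hsurj : ∀ f : E → ℝ, AnalyticAt ℝ f x → ∃ u : F → ℝ, AnalyticAt ℝ u (h x) ∧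
      GermMem (X.idealAt x) (fun z => u (h z) - f z))
    (hinj : ∀ u : F → ℝ, AnalyticAt ℝ u (h x) → GermMem (X.idealAt x) (fun z => u (h z)) →
      GermMem (Y.idealAt (h x)) u) :
    X.IsStalkIso Y h x := by
  refine ⟨hh, ?_⟩
  let q : Y.Stalk (h x) →+* X.Stalk x :=
    Ideal.quotientMap _ (analyticGermsPull h hh rfl) (idealAt_le_comap hh rfl hwd)
  have hq : ∀ (f : F → ℝ) (hf : AnalyticAt ℝ f (h x)) (hfh : AnalyticAt ℝ (f ∘ h) x),
      q (Ideal.Quotient.mk _ (analyticGerm f hf)) =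
        Ideal.Quotient.mk _ (analyticGerm (f ∘ h) hfh) := fun f hf hfh => by
    simp only [q, Ideal.quotientMap_mk]
    rfl
  refine ⟨RingEquiv.ofBijective q ⟨?_, ?_⟩, hq⟩
  · rw [injective_iff_map_eq_zero]
    intro γ hγ
    obtain ⟨⟨_, u, hu, rfl⟩, rfl⟩ := Ideal.Quotient.mk_surjective γ
    change q (Ideal.Quotient.mk _ (analyticGerm u hu)) = 0 at hγ
    rw [hq u hu (hu.comp hh), Ideal.Quotient.eq_zero_iff_mem] at hγ
    exact Ideal.Quotient.eq_zero_iff_mem.2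
      ((hinj u hu (.of_analyticGerm_mem hγ)).analyticGerm_mem hu)
  · intro δ
    obtain ⟨⟨_, f, hf, rfl⟩, rfl⟩ := Ideal.Quotient.mk_surjective δ
    obtain ⟨u, hu, huf⟩ := hsurj f hf
    refine ⟨Ideal.Quotient.mk _ (analyticGerm u hu), ?_⟩
    rw [hq u hu (hu.comp hh), Ideal.Quotient.eq]
    exact huf.analyticGerm_mem ((hu.comp hh).sub hf)

theorem IsStalkIso.exists_germMem {h : E → F} {x : E} (hs : X.IsStalkIso Y h x) {f : E → ℝ}
    (hf : AnalyticAt ℝ f x) : ∃ u : F → ℝ, AnalyticAt ℝ u (h x) ∧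
      GermMem (X.idealAt x) (fun z => f z - u (h z)) := by
  obtain ⟨hh, e, he⟩ := hs
  obtain ⟨γ, hγ⟩ := Ideal.Quotient.mk_surjective (e.symm (Ideal.Quotient.mk _ (analyticGerm f hf)))
  obtain ⟨_, u, hu, rfl⟩ := γ
  have h1 := he u hu (hu.comp hh)
  change Ideal.Quotient.mk _ (analyticGerm u hu) = _ at hγ
  rw [hγ, e.apply_symm_apply, Ideal.Quotient.eq] at h1
  exact ⟨u, hu, .of_analyticGerm_mem (hf := hf.sub (hu.comp hh)) h1⟩

/-- Near its point `φ`, the space `X` is reduced and `h` identifies it with an open subset of `F`,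
with inverse the analytic map `g`. -/
structure IsAnalyticSection (X : AnalyticModel E) (h : E → F) (φ : E) (g : F → E) : Prop where
  analyticAt : AnalyticAt ℝ g (h φ)
  apply_eq : g (h φ) = φ
  mem_points : ∀ᶠ y in 𝓝 (h φ), g y ∈ X.points ∧ h (g y) = y
  left_inv : ∀ᶠ z in 𝓝 φ, z ∈ X.points → g (h z) = z
  germMem : ∀ u : E → ℝ, AnalyticAt ℝ u φ → (∀ᶠ z in 𝓝 φ, z ∈ X.points → u z = 0) →
    GermMem (X.idealAt φ) u

/-- Surjectivity on stalks writes each linear coordinate of `E`, modulo the ideal, as `c i ∘ h`. The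
functions `c i` are the coordinates of the section. The space is reduced at `φ` because the local
rings of the target are rings of function germs. -/
theorem IsLocalIsoAt.exists_isAnalyticSection [FiniteDimensional ℝ E] {h : E → F} {φ : E}
    (hφ : φ ∈ X.points) (hloc : X.IsLocalIsoAt (whole F) h φ) :
    ∃ g, X.IsAnalyticSection h φ g := by
  obtain ⟨U, V, hφU, hφV, hU, hV, ⟨e, he⟩, hst⟩ := hloc
  have hs := hst φ ⟨hφ, hφU⟩
  have hh : AnalyticAt ℝ h φ := hs.1
  let b := Module.finBasis ℝ E
  choose c hc hcm using fun i => hs.exists_germMem ((b.coord i).toContinuousLinearMap.analyticAt φ)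
  set g : F → E := fun y => ∑ i, c i y • b i with hg
  have hga : AnalyticAt ℝ g (h φ) :=
    Finset.univ.analyticAt_fun_sum fun i _ => (hc i).smul analyticAt_const
  have hleft : ∀ᶠ z in 𝓝 φ, z ∈ X.points → g (h z) = z := by
    have : ∀ᶠ z in 𝓝 φ, ∀ i, z ∈ X.points → b.coord i z - c i (h z) = 0 :=
      eventually_all.2 fun i => eventually_eq_zero_of_germMem (hcm i)
    filter_upwards [this] with z hz hzX
    conv_rhs => rw [← b.sum_repr z]
    refine Finset.sum_congr rfl fun i _ => ?_
    rw [← sub_eq_zero.1 (hz i hzX)]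
    rfl
  have hmem : ∀ᶠ y in 𝓝 (h φ), g y ∈ X.points ∧ h (g y) = y := by
    have hy0 : h φ ∈ (whole F).points ∩ V := ⟨⟨mem_univ _, fun _ h => h.elim⟩, hφV⟩
    have hopen : (whole F).points ∩ V = V :=
      inter_eq_right.2 fun y _ => ⟨mem_univ _, fun _ h => h.elim⟩
    have he0 : e.symm ⟨h φ, hy0⟩ = ⟨φ, hφ, hφU⟩ := by
      rw [Homeomorph.symm_apply_eq]
      exact Subtype.ext (he ⟨φ, hφ, hφU⟩).symm
    -- Inverse images of points near `h φ` are points of `X` near `φ`, where `hleft` identifies them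
    -- with the values of `g`.
    have ht : Tendsto (fun y : ↥((whole F).points ∩ V) => (e.symm y : E)) (𝓝 ⟨h φ, hy0⟩) (𝓝 φ) := by
      have : Continuous fun y : ↥((whole F).points ∩ V) => (e.symm y : E) := by fun_prop
      have := this.tendsto ⟨h φ, hy0⟩
      rwa [he0] at this
    have h1 := ht.eventually hleft
    have h2 : ∀ᶠ y : ↥((whole F).points ∩ V) in 𝓝 ⟨h φ, hy0⟩,
        g (y : F) ∈ X.points ∧ h (g (y : F)) = y := by
      filter_upwards [h1] with y hy
      have hz := (e.symm y).2
      have hhz : h (e.symm y) = y := by rw [← he, e.apply_symm_apply]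
      have := hy hz.1
      rw [hhz] at this
      rw [this]
      exact ⟨hz.1, hhz⟩
    have h3 := (IsOpen.isOpenEmbedding_subtypeVal (hopen.symm ▸ hV :
      IsOpen ((whole F).points ∩ V))).map_nhds_eq
      (⟨h φ, hy0⟩ : ↥((whole F).points ∩ V))
    rw [← h3]
    exact h2
  refine ⟨g, hga, hleft.self_of_nhds hφ, hmem, hleft, fun u hu hu0 => ?_⟩
  obtain ⟨w, hw, hwm⟩ := hs.exists_germMem hu
  have hgt : Tendsto g (𝓝 (h φ)) (𝓝 φ) := by
    have := hga.continuousAt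
    rwa [ContinuousAt, hleft.self_of_nhds hφ] at this
  -- Every `y` near `h φ` is `h (g y)` with `g y` a point of `X`, so `w` vanishes on a full
  -- neighbourhood and not only on a subset.
  have hw0 : ∀ᶠ y in 𝓝 (h φ), w y = 0 := by
    filter_upwards [hmem, hgt.eventually hu0,
      hgt.eventually (eventually_eq_zero_of_germMem hwm)] with y h1 h2 h3
    have h4 := h3 h1.1
    rw [h2 h1.1, h1.2] at h4
    linarith
  have h5 : GermMem (X.idealAt φ) (fun z => w (h z)) :=
    .of_eventuallyEq_zero (hh.continuousAt.eventually hw0)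
  simpa using hwm.add h5

/-- Analytic sections are transported by maps that induce an automorphism of the space over `F`. -/
theorem IsAnalyticSection.map [FiniteDimensional ℝ E] {h : E → F} {a b : E → E} {φ ψ : E}
    {g : F → E} (hg : X.IsAnalyticSection h φ g)
    (ha : AnalyticAt ℝ a φ) (hb : AnalyticAt ℝ b ψ) (hψ : a φ = ψ) (hφ : b ψ = φ)
    (haX : ∀ z ∈ X.points, a z ∈ X.points ∧ h (a z) = h z ∧ b (a z) = z)
    (hbX : ∀ z ∈ X.points, b z ∈ X.points ∧ a (b z) = z)
    (hφX : φ ∈ X.points)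
    (hpull : ∀ k ∈ X.eqs, AnalyticAt ℝ k φ → GermMem (X.idealAt ψ) (k ∘ b))
    (hid : ∀ l : E →L[ℝ] ℝ, GermMem (X.idealAt ψ) (fun z => l (a (b z)) - l z)) :
    X.IsAnalyticSection h ψ (a ∘ g) := by
  have hhψ : h ψ = h φ := by rw [← hψ, (haX φ hφX).2.1]
  have hhb : ∀ z ∈ X.points, h (b z) = h z := fun z hz => by
    have := (haX _ (hbX z hz).1).2.1
    rw [(hbX z hz).2] at this
    exact this.symm
  have hbt : Tendsto b (𝓝 ψ) (𝓝 φ) := by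
    have := hb.continuousAt
    rwa [ContinuousAt, hφ] at this
  have hat : Tendsto a (𝓝 φ) (𝓝 ψ) := by
    have := ha.continuousAt
    rwa [ContinuousAt, hψ] at this
  refine ⟨?_, ?_, ?_, ?_, ?_⟩
  · rw [hhψ]
    refine AnalyticAt.comp ?_ hg.analyticAt
    rwa [hg.apply_eq]
  · rw [hhψ, Function.comp, hg.apply_eq, hψ]
  · rw [hhψ]
    filter_upwards [hg.mem_points] with y hy
    exact ⟨(haX _ hy.1).1, (haX _ hy.1).2.1.trans hy.2⟩
  · filter_upwards [hbt.eventually hg.left_inv] with z hz hzX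
    have := hz (hbX z hzX).1
    rw [hhb z hzX] at this
    rw [Function.comp, this, (hbX z hzX).2]
  -- Reducedness is pulled back along `a` and then along `b`. This puts `u ∘ a ∘ b` in the ideal,
  -- and `a ∘ b` is the identity modulo the ideal, so Hadamard's lemma replaces `u ∘ a ∘ b` by `u`.
  · intro u hu hu0
    have h1 : GermMem (X.idealAt φ) (fun z => u (a z)) := by
      refine hg.germMem _ (AnalyticAt.fun_comp (by rwa [hψ]) ha) ?_
      filter_upwards [hat.eventually hu0] with z hz hzX
      exact hz (haX z hzX).1
    have h2 : GermMem (X.idealAt ψ) (fun z => u (a (b z))) := germMem_comp hb hφ hpull h1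
    have h3 : GermMem (X.idealAt ψ) (fun z => u (a (b z)) - u z) :=
      GermMem.comp_sub_comp (r := fun z => a (b z)) (s := fun z => z) hu
        (AnalyticAt.fun_comp (by rwa [hφ]) hb) analyticAt_id (by rw [hφ, hψ]) rfl hid
    simpa using h2.sub h3

end AnalyticModel

end GermIdeals

/-! ### Real coordinates and the points of the configuration scheme -/

namespace MarkedLinkage

section Coordinates

variable {V E : Type*} {s : ℕ}

@[simp] theorem coords_zero (φ : V → ℂ) (v : V) : coords φ (v, 0) = (φ v).re := if_pos rfl

@[simp] theorem coords_one (φ : V → ℂ) (v : V) : coords φ (v, 1) = (φ v).im :=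
  if_neg one_ne_zero

theorem coords_injective : Function.Injective (coords (V := V)) := fun φ ψ h => by
  funext v
  apply Complex.ext
  · simpa using congrFun h (v, 0)
  · simpa using congrFun h (v, 1)

theorem eval_edgeEq (L : MarkedLinkage V E s) (φ : V → ℂ) (e : E) :
    MvPolynomial.eval (coords φ) (L.edgeEq e) =
      ‖φ (L.ends e).1 - φ (L.ends e).2‖ ^ 2 - L.len e ^ 2 := by
  rw [Complex.sq_norm, Complex.normSq_apply]
  simp [edgeEq]
  ring

theorem eval_barEq_eq_zero_iff {L : MetricGraph V E} (t : DegenerateTriangle L) (φ : V → ℂ) :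
    (∀ i, MvPolynomial.eval (coords φ) (barEq t i) = 0) ↔
      φ t.B = ((L.len t.BC / L.len t.AC : ℝ) : ℂ) * φ t.A +
        ((L.len t.AB / L.len t.AC : ℝ) : ℂ) * φ t.C := by
  rw [Fin.forall_fin_two, Complex.ext_iff]
  simp only [barEq, map_sub, map_mul, MvPolynomial.eval_X, MvPolynomial.eval_C, coords_zero,
    coords_one, Complex.add_re, Complex.add_im, Complex.re_ofReal_mul, Complex.im_ofReal_mul]
  constructor
  · rintro ⟨h1, h2⟩
    exact ⟨by linarith, by linarith⟩
  · rintro ⟨h1, h2⟩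
    exact ⟨by linarith, by linarith⟩

theorem eval_markEq_eq_zero_iff (L : MarkedLinkage V E s) (Z : Fin s → ℂ) (i : Fin s)
    (φ : V → ℂ) : (∀ k, MvPolynomial.eval (coords φ) (L.markEq Z i k) = 0) ↔
      φ (L.mark i) = Z i := by
  rw [Fin.forall_fin_two, Complex.ext_iff]
  simp [markEq, sub_eq_zero]

end Coordinates

section Points

variable {V E : Type*} {s : ℕ}

/-- Equality in the triangle inequality puts `b` on the segment from `a` to `c`, and the distances
determine its parameter. -/
theorem _root_.eq_div_mul_add_div_mul_of_norm_sub {a b c : ℂ} {p q : ℝ} (hp : 0 < p) (hq : 0 < q)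
    (hab : ‖a - b‖ = p) (hbc : ‖b - c‖ = q) (hac : ‖a - c‖ = p + q) :
    b = ((q / (p + q) : ℝ) : ℂ) * a + ((p / (p + q) : ℝ) : ℂ) * c := by
  have hw : Wbtw ℝ a b c := by
    rw [← dist_add_dist_eq_iff, dist_eq_norm, dist_eq_norm, dist_eq_norm, hab, hbc, hac]
  obtain ⟨t, ht, rfl⟩ := hw
  have hpq : 0 < p + q := add_pos hp hq
  have h1 : ‖a - AffineMap.lineMap a c t‖ = t * ‖a - c‖ := by
    rw [← dist_eq_norm, dist_left_lineMap, Real.norm_of_nonneg ht.1, dist_eq_norm]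
  have h2 : t = p / (p + q) := by
    rw [eq_div_iff hpq.ne', ← hac, ← h1, hab]
  have h3 : q / (p + q) = 1 - t := by
    rw [h2]
    field_simp
    ring
  rw [h3, ← h2, AffineMap.lineMap_apply]
  simp
  ring

theorem norm_sub_of_mem_config {L : MarkedLinkage V E s} {φ : V → ℂ}
    (h : ∀ e, ‖φ (L.ends e).1 - φ (L.ends e).2‖ ^ 2 = L.len e ^ 2) {e : E} {v w : V}
    (he : L.ends e = (v, w) ∨ L.ends e = (w, v)) : ‖φ v - φ w‖ = L.len e := by
  have := h e
  rw [sq_eq_sq₀ (norm_nonneg _) (L.len_pos e).le] at this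
  rcases he with he | he
  · rwa [he] at this
  · rwa [he, norm_sub_rev] at this

/-- Replacing the equations of the short edges of bars by linear ones does not change the set of
realizations. -/
theorem points_analyticSpace [Finite E] (L : MarkedLinkage V E s) (Z : Fin s → ℂ) :
    (L.analyticSpace Z).points = L.config Z := by
  ext φ
  constructor
  · rintro ⟨-, h⟩
    have hE : ∀ e, (∀ t ∈ L.bars, e ≠ t.AB ∧ e ≠ t.BC) →
        ‖φ (L.ends e).1 - φ (L.ends e).2‖ ^ 2 = L.len e ^ 2 := fun e he => by
      have := h _ ⟨_, Or.inl (Or.inl ⟨e, he, rfl⟩), rfl⟩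
      rw [eval_edgeEq] at this
      linarith
    have hB : ∀ t ∈ L.bars, φ t.B = ((L.len t.BC / L.len t.AC : ℝ) : ℂ) * φ t.A +
        ((L.len t.AB / L.len t.AC : ℝ) : ℂ) * φ t.C := fun t ht =>
      (eval_barEq_eq_zero_iff t φ).1 fun i => h _ ⟨_, Or.inl (Or.inr ⟨t, ht, i, rfl⟩), rfl⟩
    have hM : ∀ i, φ (L.mark i) = Z i := fun i =>
      (L.eval_markEq_eq_zero_iff Z i φ).1 fun k => h _ ⟨_, Or.inr ⟨i, k, rfl⟩, rfl⟩
    refine ⟨fun e => ?_, hM⟩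
    -- A replaced edge gets its length from the long edge `AC` of its bar, which may itself be a
    -- short edge of another bar. As `AC` is strictly longer and there are finitely many edges, one
    -- can induct from the longest edges down.
    have wf : WellFounded fun a b : E => L.len b < L.len a :=
      @Finite.wellFounded_of_trans_of_irrefl _ _ _
        ⟨fun _ _ _ h1 h2 => h2.trans h1⟩ ⟨fun _ => lt_irrefl _⟩
    induction e using wf.induction with
    | _ e ih =>
    by_cases he : ∀ t ∈ L.bars, e ≠ t.AB ∧ e ≠ t.BC
    · exact hE e he
    push Not at he
    obtain ⟨t, ht, he⟩ := he
    have h1 := L.len_pos t.AB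
    have h2 := L.len_pos t.BC
    have h3 := L.len_pos t.AC
    have h4 := t.len_AC
    have hsum : L.len t.BC / L.len t.AC + L.len t.AB / L.len t.AC = 1 := by
      rw [← add_div, add_comm, ← h4, div_self h3.ne']
    have hsum' : ((L.len t.BC / L.len t.AC : ℝ) : ℂ) + ((L.len t.AB / L.len t.AC : ℝ) : ℂ) = 1 := by
      rw [← Complex.ofReal_add, hsum, Complex.ofReal_one]
    have hlong : L.len e < L.len t.AC → ‖φ t.A - φ t.C‖ = L.len t.AC := fun hlt => by
      have := ih t.AC hlt
      rw [sq_eq_sq₀ (norm_nonneg _) h3.le] at this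
      rcases t.ends_AC with h' | h'
      · rwa [h'] at this
      · rwa [h', norm_sub_rev] at this
    by_cases heAB : e = t.AB
    · subst heAB
      have h5 : φ t.A - φ t.B = ((L.len t.AB / L.len t.AC : ℝ) : ℂ) * (φ t.A - φ t.C) := by
        rw [hB t ht]
        linear_combination -φ t.A * hsum'
      have h6 : ‖φ t.A - φ t.B‖ = L.len t.AB := by
        rw [h5, norm_mul, hlong (by linarith), Complex.norm_of_nonneg (by positivity),
          div_mul_cancel₀ _ h3.ne']
      rcases t.ends_AB with h' | h'
      · rw [h', h6]
      · rw [h', norm_sub_rev, h6]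
    · have heBC := he heAB
      subst heBC
      have h5 : φ t.B - φ t.C = ((L.len t.BC / L.len t.AC : ℝ) : ℂ) * (φ t.A - φ t.C) := by
        rw [hB t ht]
        linear_combination φ t.C * hsum'
      have h6 : ‖φ t.B - φ t.C‖ = L.len t.BC := by
        rw [h5, norm_mul, hlong (by linarith), Complex.norm_of_nonneg (by positivity),
          div_mul_cancel₀ _ h3.ne']
      rcases t.ends_BC with h' | h'
      · rw [h', h6]
      · rw [h', norm_sub_rev, h6]
  · rintro ⟨h1, h2⟩
    refine ⟨mem_univ _, ?_⟩
    rintro _ ⟨_, (⟨e, -, rfl⟩ | ⟨t, -, i, rfl⟩) | ⟨i, k, rfl⟩, rfl⟩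
    · exact (L.eval_edgeEq φ e).trans (by rw [h1, sub_self])
    · refine (eval_barEq_eq_zero_iff t φ).2 ?_ i
      rw [t.len_AC]
      refine eq_div_mul_add_div_mul_of_norm_sub (L.len_pos _) (L.len_pos _)
        (norm_sub_of_mem_config h1 t.ends_AB) (norm_sub_of_mem_config h1 t.ends_BC) ?_
      rw [← t.len_AC]
      exact norm_sub_of_mem_config h1 t.ends_AC
    · exact (L.eval_markEq_eq_zero_iff Z i φ).2 (h2 i) k

end Points

/-! ### Polynomial maps and the action of scheme automorphisms -/

section PolynomialMaps

variable {V E : Type*} {s : ℕ}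

/-- The map `V → ℂ` whose real coordinates are given by polynomials. -/
def polyMap {W : Type*} (c : W × Fin 2 → MvPolynomial (V × Fin 2) ℝ) (φ : V → ℂ) : W → ℂ :=
  fun w => ⟨MvPolynomial.eval (coords φ) (c (w, 0)), MvPolynomial.eval (coords φ) (c (w, 1))⟩

theorem coords_polyMap {W : Type*} (c : W × Fin 2 → MvPolynomial (V × Fin 2) ℝ) (φ : V → ℂ) :
    coords (polyMap c φ) = fun i => MvPolynomial.eval (coords φ) (c i) := by
  funext ⟨w, i⟩
  fin_cases i
  · exact coords_zero _ _
  · exact coords_one _ _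

theorem eval_coords_polyMap {W : Type*} (c : W × Fin 2 → MvPolynomial (V × Fin 2) ℝ) (φ : V → ℂ)
    (k : MvPolynomial (W × Fin 2) ℝ) : MvPolynomial.eval (coords (polyMap c φ)) k =
      MvPolynomial.eval (coords φ) (MvPolynomial.bind₁ c k) := by
  rw [coords_polyMap]
  exact (MvPolynomial.aeval_bind₁ (coords φ) c k).symm

/-- A scheme automorphism and its inverse are given by polynomials. -/
theorem IsSchemeAutomorphism.exists_polyMap {L : MarkedLinkage V E s} {Z : Fin s → ℂ}
    {σ : L.config Z ≃ₜ L.config Z}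
    (hσ : L.IsSchemeAutomorphism Z σ) :
    ∃ c d : V × Fin 2 → MvPolynomial (V × Fin 2) ℝ,
      (∀ φ : L.config Z, polyMap c φ = (σ φ : V → ℂ)) ∧
      (∀ φ : L.config Z, polyMap d (σ φ : V → ℂ) = φ) ∧
      (∀ k ∈ L.schemeIdeal Z, MvPolynomial.bind₁ d k ∈ L.schemeIdeal Z) ∧
      ∀ i, MvPolynomial.bind₁ d (c i) - MvPolynomial.X i ∈ L.schemeIdeal Z := by
  obtain ⟨α, hα⟩ := hσ
  -- Pull-back of functions: representatives of `α (X i)` are the coordinates of `σ`, and those of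
  -- `α.symm (X i)` are the coordinates of its inverse.
  choose c hc using fun i => Ideal.Quotient.mk_surjective (I := L.schemeIdeal Z)
    (α (Ideal.Quotient.mk _ (MvPolynomial.X i)))
  choose d hd using fun i => Ideal.Quotient.mk_surjective (I := L.schemeIdeal Z)
    (α.symm (Ideal.Quotient.mk _ (MvPolynomial.X i)))
  have hbind : ∀ k, Ideal.Quotient.mk (L.schemeIdeal Z) (MvPolynomial.bind₁ d k) =
      α.symm (Ideal.Quotient.mk _ k) := by
    intro k
    have : (Ideal.Quotient.mkₐ ℝ (L.schemeIdeal Z)).comp (MvPolynomial.bind₁ d) =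
        (α.symm : _ →ₐ[ℝ] _).comp (Ideal.Quotient.mkₐ ℝ (L.schemeIdeal Z)) := by
      refine MvPolynomial.algHom_ext fun i => ?_
      simpa using hd i
    exact DFunLike.congr_fun this k
  refine ⟨c, d, fun φ => coords_injective ?_, fun φ => coords_injective ?_, fun k hk => ?_,
    fun i => ?_⟩
  · rw [coords_polyMap]
    funext i
    rw [← hα _ _ (hc i).symm φ, MvPolynomial.eval_X]
  · rw [coords_polyMap]
    funext i
    rw [hα (d i) (MvPolynomial.X i) (by rw [hd, α.apply_symm_apply]) φ, MvPolynomial.eval_X]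
  · rw [← Ideal.Quotient.eq_zero_iff_mem, hbind, Ideal.Quotient.eq_zero_iff_mem.2 hk, map_zero]
  · rw [← Ideal.Quotient.eq, hbind, hc, α.symm_apply_apply]

variable [Fintype V]

theorem analyticAt_coords (i : V × Fin 2) (φ : V → ℂ) : AnalyticAt ℝ (fun φ => coords φ i) φ := by
  by_cases h : i.2 = 0
  · simp only [coords, h, if_true]
    exact (Complex.reCLM.comp (ContinuousLinearMap.proj (R := ℝ) (φ := fun _ => ℂ) i.1)).analyticAt φ
  · simp only [coords, h, if_false]
    exact (Complex.imCLM.comp (ContinuousLinearMap.proj (R := ℝ) (φ := fun _ => ℂ) i.1)).analyticAt φ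

theorem analyticAt_eval_coords (k : MvPolynomial (V × Fin 2) ℝ) (φ : V → ℂ) :
    AnalyticAt ℝ (fun φ => MvPolynomial.eval (coords φ) k) φ :=
  AnalyticAt.aeval_mvPolynomial (fun i => analyticAt_coords i φ) k

theorem analyticAt_of_coords {F : Type*} [NormedAddCommGroup F] [NormedSpace ℝ F] {r : F → V → ℂ}
    {y : F} (h : ∀ i, AnalyticAt ℝ (fun z => coords (r z) i) y) : AnalyticAt ℝ r y := by
  rw [analyticAt_pi_iff]
  intro v
  have h0 := h (v, 0)
  have h1 := h (v, 1)
  simp only [coords_zero, coords_one] at h0 h1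
  have := ((Complex.ofRealCLM.analyticAt _).fun_comp h0).add
    (((Complex.ofRealCLM.analyticAt _).fun_comp h1).mul (analyticAt_const (v := Complex.I)))
  refine this.congr (Eventually.of_forall fun z => ?_)
  exact Complex.re_add_im (r z v)

theorem analyticAt_polyMap {W : Type*} [Fintype W] (c : W × Fin 2 → MvPolynomial (V × Fin 2) ℝ)
    (φ : V → ℂ) : AnalyticAt ℝ (polyMap c) φ := by
  refine analyticAt_of_coords fun i => ?_
  simp only [coords_polyMap]
  exact analyticAt_eval_coords _ _

/-- A real linear functional is a combination of the coordinates. This reduces the hypothesis of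
`GermMem.comp_sub_comp` on all functionals to one on coordinates. -/
theorem germMem_clm_sub {F : Type*} [NormedAddCommGroup F] [NormedSpace ℝ F] {y : F}
    {I : Ideal (analyticGerms y)} {r q : F → V → ℂ}
    (h : ∀ i, GermMem I (fun z => coords (r z) i - coords (q z) i)) (l : (V → ℂ) →L[ℝ] ℝ) :
    GermMem I (fun z => l (r z) - l (q z)) := by
  classical
  have hl : ∀ w : V → ℂ, l w = ∑ v, (l (Pi.single v 1) * (w v).re +
      l (Pi.single v Complex.I) * (w v).im) := by
    intro w
    have : w = ∑ v, ((w v).re • (Pi.single v 1 : V → ℂ) +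
        (w v).im • (Pi.single v Complex.I : V → ℂ)) := by
      funext v
      rw [Finset.sum_apply, Finset.sum_eq_single v]
      · simp
      · intro u _ huv
        simp [Pi.single_eq_of_ne huv.symm]
      · simp
    conv_lhs => rw [this]
    simp only [map_sum, map_add, map_smul, smul_eq_mul, mul_comm]
  have key : GermMem I (fun z => ∑ v, (l (Pi.single v 1) * (coords (r z) (v, 0) -
      coords (q z) (v, 0)) + l (Pi.single v Complex.I) * (coords (r z) (v, 1) -
      coords (q z) (v, 1)))) :=
    GermMem.sum fun v _ => ((h (v, 0)).const_mul _).add ((h (v, 1)).const_mul _)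
  refine key.congr (Eventually.of_forall fun z => ?_)
  simp only [hl (r z), hl (q z), ← Finset.sum_sub_distrib, coords_zero, coords_one]
  exact Finset.sum_congr rfl fun v _ => by ring

variable (L : MarkedLinkage V E s) (Z : Fin s → ℂ)

theorem germMem_of_mem_schemeEqs (ψ : V → ℂ) {k : MvPolynomial (V × Fin 2) ℝ}
    (hk : k ∈ L.schemeEqs Z) :
    GermMem ((L.analyticSpace Z).idealAt ψ) (fun φ => MvPolynomial.eval (coords φ) k) :=
  AnalyticModel.germMem_of_mem_eqs ⟨k, hk, rfl⟩ (analyticAt_eval_coords k ψ)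

theorem germMem_of_mem_schemeIdeal (ψ : V → ℂ) {k : MvPolynomial (V × Fin 2) ℝ}
    (hk : k ∈ L.schemeIdeal Z) :
    GermMem ((L.analyticSpace Z).idealAt ψ) (fun φ => MvPolynomial.eval (coords φ) k) := by
  refine Submodule.span_induction (p := fun k _ => GermMem ((L.analyticSpace Z).idealAt ψ)
    (fun φ => MvPolynomial.eval (coords φ) k)) ?_ ?_ ?_ ?_ hk
  · exact fun k hk => L.germMem_of_mem_schemeEqs Z ψ hk
  · exact .of_eventuallyEq_zero (by simp)
  · intro k k' _ _ h h'
    simpa using h.add h'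
  · intro a k _ h
    simpa using h.mul_left (analyticAt_eval_coords a ψ)

variable {L Z}

/-- Scheme automorphisms over `F` transport analytic sections. -/
theorem IsSchemeAutomorphism.exists_isAnalyticSection [Finite E] {F : Type*}
    [NormedAddCommGroup F] [NormedSpace ℝ F] {h : (V → ℂ) → F}
    {σ : L.config Z ≃ₜ L.config Z} (hσ : L.IsSchemeAutomorphism Z σ)
    (hσh : ∀ φ : L.config Z, h (σ φ) = h φ) {φ : L.config Z}
    (hφ : ∃ g, (L.analyticSpace Z).IsAnalyticSection h φ g) :
    ∃ g, (L.analyticSpace Z).IsAnalyticSection h (σ φ) g := by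
  obtain ⟨g, hg⟩ := hφ
  obtain ⟨c, d, hc, hd, hI, hid⟩ := hσ.exists_polyMap
  have hpts := L.points_analyticSpace Z
  refine ⟨_, hg.map (analyticAt_polyMap c _) (analyticAt_polyMap d _) (hc φ) (hd φ) ?_ ?_ ?_ ?_ ?_⟩
  · rw [hpts]
    intro z hz
    have := hc ⟨z, hz⟩
    simp only at this
    rw [this]
    exact ⟨(σ _).2, hσh _, hd _⟩
  · rw [hpts]
    intro z hz
    have := hd (σ.symm ⟨z, hz⟩)
    rw [σ.apply_symm_apply] at this
    simp only at this
    rw [this, hc, σ.apply_symm_apply]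
    exact ⟨(σ.symm _).2, rfl⟩
  · rw [hpts]
    exact φ.2
  · rintro _ ⟨k, hk, rfl⟩ -
    refine (L.germMem_of_mem_schemeIdeal Z _ (hI k (Ideal.subset_span hk))).congr ?_
    exact Eventually.of_forall fun z => (eval_coords_polyMap d z k).symm
  -- The polynomials `bind₁ d (c i) - X i` lie in the scheme ideal, which says that the two
  -- polynomial maps compose to the identity modulo the ideal.
  · refine germMem_clm_sub (q := fun z => z) fun i => ?_
    refine (L.germMem_of_mem_schemeIdeal Z _ (hid i)).congr (Eventually.of_forall fun z => ?_)
    simp only [coords_polyMap, map_sub, MvPolynomial.eval_X, ← eval_coords_polyMap]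

end PolynomialMaps

end MarkedLinkage

/-! ### The input map as a real linear map -/

section Plane

variable {𝕜 : Type*} [RCLike 𝕜]

theorem ofPlane_planeOf (x : 𝕜) : ofPlane 𝕜 (planeOf 𝕜 x) = x := RCLike.re_add_im x

/-- The input map as a continuous real linear map. -/
def inputCLM (𝕜 : Type*) [RCLike 𝕜] {V : Type*} {m : ℕ} (P : Fin m → V) :
    (V → ℂ) →L[ℝ] (Fin m → 𝕜) where
  toFun := inputMap 𝕜 P
  map_add' φ ψ := by
    funext j
    simp only [inputMap, ofPlane, Pi.add_apply, Complex.add_re, Complex.add_im, map_add]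
    ring
  map_smul' c φ := by
    funext j
    simp only [inputMap, ofPlane, Pi.smul_apply, Complex.smul_re, Complex.smul_im, smul_eq_mul,
      RCLike.ofReal_mul, RingHom.id_apply]
    rw [RCLike.real_smul_eq_coe_mul]
    ring
  cont := by
    unfold inputMap ofPlane
    fun_prop

theorem analyticAt_inputMap {V : Type*} [Fintype V] {m : ℕ} (P : Fin m → V) (φ : V → ℂ) :
    AnalyticAt ℝ (inputMap 𝕜 P) φ :=
  (inputCLM 𝕜 P).analyticAt φ

theorem continuous_inputMap {V : Type*} {m : ℕ} (P : Fin m → V) :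
    Continuous (inputMap 𝕜 P) :=
  (inputCLM 𝕜 P).continuous

/-- The real and imaginary parts of the components of an analytic map are analytic. -/
theorem analyticAt_re_planeOf {F : Type*} [NormedAddCommGroup F] [NormedSpace ℝ F] {n : ℕ}
    {f : F → Fin n → 𝕜} {y : F} (hf : AnalyticAt ℝ f y) (j : Fin n) :
    AnalyticAt ℝ (fun z => (planeOf 𝕜 (f z j)).re) y ∧
      AnalyticAt ℝ (fun z => (planeOf 𝕜 (f z j)).im) y := by
  have hj := analyticAt_pi_iff.1 hf j
  exact ⟨(RCLike.reCLM (K := 𝕜)).analyticAt _ |>.fun_comp hj,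
    (RCLike.imCLM (K := 𝕜)).analyticAt _ |>.fun_comp hj⟩

end Plane

/-! ### Equations of the glued linkage, and its local rings over the level space of `f` -/

namespace MarkedLinkage

section Gluing

variable {V E : Type*} {s n : ℕ} (A : MarkedLinkage V E s) (Z : Fin s → ℂ) (Q : Fin n → V)
  (J : Set (Fin n)) (β : J → Fin s)

/-- Realizations of the glued vertices as realizations of the original ones. -/
def pullGlue (φ : GluedVertex A.mark Q J β → ℂ) : V → ℂ := fun v => φ (glue A.mark Q J β v)

/-- Restriction of a realization to representatives of the glued vertices. -/
def restrictGlue (φ : V → ℂ) : GluedVertex A.mark Q J β → ℂ := fun v => φ (Quot.out v)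

theorem restrictGlue_pullGlue (φ : GluedVertex A.mark Q J β → ℂ) :
    A.restrictGlue Q J β (A.pullGlue Q J β φ) = φ := by
  funext v
  exact congrArg φ (Quot.out_eq v)

theorem glue_out_eq (j : J) :
    glue A.mark Q J β (Q j) = glue A.mark Q J β (A.mark (β j)) :=
  Quot.sound ⟨j, rfl, rfl⟩

theorem coords_pullGlue (φ : GluedVertex A.mark Q J β → ℂ) (i : V × Fin 2) :
    coords (A.pullGlue Q J β φ) i = coords φ (Prod.map (glue A.mark Q J β) id i) := rfl

theorem coords_restrictGlue (φ : V → ℂ) (i : GluedVertex A.mark Q J β × Fin 2) :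
    coords (A.restrictGlue Q J β φ) i = coords φ (Quot.out i.1, i.2) := rfl

theorem eval_coords_pullGlue (φ : GluedVertex A.mark Q J β → ℂ)
    (k : MvPolynomial (V × Fin 2) ℝ) :
    MvPolynomial.eval (coords (A.pullGlue Q J β φ)) k =
      MvPolynomial.eval (coords φ) (MvPolynomial.rename (Prod.map (glue A.mark Q J β) id) k) := by
  rw [MvPolynomial.eval_rename]
  rfl

/-- The equations of the closed linkage are those of the original one, with vertices identified. -/
theorem schemeEqs_selfFiberSum : (A.selfFiberSum Q J β).schemeEqs Z =
    MvPolynomial.rename (Prod.map (glue A.mark Q J β) id) '' A.schemeEqs Z := by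
  have hE : ∀ e, MvPolynomial.rename (Prod.map (glue A.mark Q J β) id) (A.edgeEq e) =
      (A.selfFiberSum Q J β).edgeEq e := fun e => by
    simp [edgeEq, selfFiberSum, MetricGraph.map]
  have hB : ∀ (t : DegenerateTriangle A.toMetricGraph) i,
      MvPolynomial.rename (Prod.map (glue A.mark Q J β) id) (barEq t i) =
      barEq (t.map (glue A.mark Q J β)) i := fun t i => by
    simp [barEq, DegenerateTriangle.map, MetricGraph.map]
  have hM : ∀ i k, MvPolynomial.rename (Prod.map (glue A.mark Q J β) id) (A.markEq Z i k) =
      (A.selfFiberSum Q J β).markEq Z i k := fun i k => by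
    simp [markEq, selfFiberSum]
  ext k
  constructor
  · rintro ((⟨e, he, rfl⟩ | ⟨_, ⟨t, ht, rfl⟩, i, rfl⟩) | ⟨i, k, rfl⟩)
    · exact ⟨A.edgeEq e, Or.inl (Or.inl ⟨e, fun t ht => he _ ⟨t, ht, rfl⟩, rfl⟩), hE e⟩
    · exact ⟨barEq t i, Or.inl (Or.inr ⟨t, ht, i, rfl⟩), hB t i⟩
    · exact ⟨A.markEq Z i k, Or.inr ⟨i, k, rfl⟩, hM i k⟩
  · rintro ⟨_, (⟨e, he, rfl⟩ | ⟨t, ht, i, rfl⟩) | ⟨i, k, rfl⟩, rfl⟩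
    · refine Or.inl (Or.inl ⟨e, ?_, hE e⟩)
      rintro _ ⟨t, ht, rfl⟩
      exact he t ht
    · exact Or.inl (Or.inr ⟨_, ⟨t, ht, rfl⟩, i, hB t i⟩)
    · exact Or.inr ⟨i, k, hM i k⟩

theorem analyticAt_pullGlue [Fintype V] (φ : GluedVertex A.mark Q J β → ℂ) :
    AnalyticAt ℝ (A.pullGlue Q J β) φ :=
  analyticAt_of_coords fun i => by
    simp only [coords_pullGlue]
    exact analyticAt_coords _ _

theorem analyticAt_restrictGlue [Fintype V] (φ : V → ℂ) :
    AnalyticAt ℝ (A.restrictGlue Q J β) φ :=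
  analyticAt_of_coords fun i => by
    simp only [coords_restrictGlue]
    exact analyticAt_coords _ _

variable [Fintype V]

/-- Renaming vertices turns each equation of `A` into an equation of the closed linkage, so every
relation in a local ring of `C(A)` persists after gluing. -/
theorem germMem_pullGlue {x : GluedVertex A.mark Q J β → ℂ} {u : (V → ℂ) → ℝ}
    (hu : GermMem ((A.analyticSpace Z).idealAt (A.pullGlue Q J β x)) u) :
    GermMem (((A.selfFiberSum Q J β).analyticSpace Z).idealAt x)
      (fun z => u (A.pullGlue Q J β z)) := by
  refine AnalyticModel.germMem_comp (A.analyticAt_pullGlue Q J β x) rfl ?_ hu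
  rintro _ ⟨k, hk, rfl⟩ -
  have hk' : MvPolynomial.rename (Prod.map (glue A.mark Q J β) id) k ∈
      (A.selfFiberSum Q J β).schemeEqs Z := by
    rw [schemeEqs_selfFiberSum]
    exact ⟨k, hk, rfl⟩
  refine ((A.selfFiberSum Q J β).germMem_of_mem_schemeEqs Z x hk').congr ?_
  exact Eventually.of_forall fun z => (A.eval_coords_pullGlue Q J β z k).symm

end Gluing

section StalkIso

variable {𝕜 : Type*} [RCLike 𝕜] {V E : Type*} [Fintype V] [Finite E] {s m n : ℕ}
  {A : MarkedLinkage V E s} {Z : Fin s → ℂ} {P : Fin m → V} {Q : Fin n → V}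
  {J : Set (Fin n)} {β : J → Fin s} {f : (Fin m → 𝕜) → (Fin n → 𝕜)} {D : Set (Fin m → 𝕜)}

/-- Modulo the equations `f_j = z_{β(j)}`, the local section of the input map is compatible with the
identification of vertices. -/
theorem germMem_section_sub {φ : V → ℂ} {g : (Fin m → 𝕜) → (V → ℂ)}
    (hg : (A.analyticSpace Z).IsAnalyticSection (inputMap 𝕜 P) φ g)
    (hf : AnalyticAt ℝ f (inputMap 𝕜 P φ))
    (hout : ∀ ψ ∈ A.config Z, ∀ j, ψ (Q j) = planeOf 𝕜 (f (inputMap 𝕜 P ψ) j))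
    (i : V × Fin 2) :
    GermMem ((levelSpace D f Z J β).idealAt (inputMap 𝕜 P φ)) (fun y =>
      coords (A.pullGlue Q J β (A.restrictGlue Q J β (g y))) i - coords (g y) i) := by
  set I := (levelSpace D f Z J β).idealAt (inputMap 𝕜 P φ) with hI
  have hmem : ∀ᶠ y in 𝓝 (inputMap 𝕜 P φ), g y ∈ A.config Z ∧ inputMap 𝕜 P (g y) = y := by
    rw [← A.points_analyticSpace Z]
    exact hg.mem_points
  -- The point `g y` is a realization of `A` with input `y`. Its fixed vertices are exactly at `Z`
  -- and its outputs are `f y`, so the difference is a generator of the level ideal.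
  have hgen : ∀ (j : J) k, GermMem I (fun y => coords (g y) (Q j, k) -
      coords (g y) (A.mark (β j), k)) := by
    intro j k
    obtain ⟨h1, h2⟩ := analyticAt_re_planeOf hf (j : Fin n)
    fin_cases k
    · refine (AnalyticModel.germMem_of_mem_eqs (X := levelSpace D f Z J β)
        ⟨j, Or.inl rfl⟩ (h1.sub analyticAt_const)).congr ?_
      filter_upwards [hmem] with y hy
      simp only [Fin.zero_eta, coords_zero, hy.1.2 (β j), hout _ hy.1, hy.2, Complex.sub_re]
    · refine (AnalyticModel.germMem_of_mem_eqs (X := levelSpace D f Z J β)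
        ⟨j, Or.inr rfl⟩ (h2.sub analyticAt_const)).congr ?_
      filter_upwards [hmem] with y hy
      simp only [Fin.mk_one, coords_one, hy.1.2 (β j), hout _ hy.1, hy.2, Complex.sub_im]
  -- A vertex and the chosen representative of its class are joined only by a chain of
  -- identifications, so the congruence is propagated along the generated equivalence relation.
  have hrel : ∀ v w : V, Relation.EqvGen (fun a b : V => ∃ j : J, a = Q j ∧ b = A.mark (β j)) v w →
      ∀ k, GermMem I (fun y => coords (g y) (v, k) - coords (g y) (w, k)) := by
    intro v w h k
    induction h with
    | rel v w h =>
      obtain ⟨j, rfl, rfl⟩ := h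
      exact hgen j k
    | refl v => exact .of_eventuallyEq_zero (by simp)
    | symm v w _ ih => simpa using ih.neg
    | trans u v w _ _ ih1 ih2 => simpa using ih1.add ih2
  obtain ⟨v, k⟩ := i
  exact hrel _ _ (Quot.eqvGen_exact (Quot.out_eq (glue A.mark Q J β v))) k

/-- At a point where the input map of `A` has an analytic section, the input map of the closed
linkage induces an isomorphism of local rings onto the level space of `f`. -/
theorem isStalkIso_selfFiberSum {x : GluedVertex A.mark Q J β → ℂ} {g : (Fin m → 𝕜) → (V → ℂ)}
    (hg : (A.analyticSpace Z).IsAnalyticSection (inputMap 𝕜 P) (A.pullGlue Q J β x) g)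
    (hf : AnalyticAt ℝ f (inputMap 𝕜 (gluedInput A.mark Q J β P) x))
    (hout : ∀ ψ ∈ A.config Z, ∀ j, ψ (Q j) = planeOf 𝕜 (f (inputMap 𝕜 P ψ) j)) :
    ((A.selfFiberSum Q J β).analyticSpace Z).IsStalkIso (levelSpace D f Z J β)
      (inputMap 𝕜 (gluedInput A.mark Q J β P)) x := by
  have hP : ∀ z, inputMap 𝕜 (gluedInput A.mark Q J β P) z = inputMap 𝕜 P (A.pullGlue Q J β z) :=
    fun _ => rfl
  have hpts := A.points_analyticSpace Z
  have hgx : AnalyticAt ℝ g (inputMap 𝕜 (gluedInput A.mark Q J β P) x) := hg.analyticAt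
  have hgx' : g (inputMap 𝕜 (gluedInput A.mark Q J β P) x) = A.pullGlue Q J β x := hg.apply_eq
  have hf' : AnalyticAt ℝ f (inputMap 𝕜 P (A.pullGlue Q J β x)) := hf
  have hfp : AnalyticAt ℝ (fun w => f (inputMap 𝕜 P w)) (A.pullGlue Q J β x) :=
    hf'.fun_comp (analyticAt_inputMap P _)
  refine AnalyticModel.isStalkIso_of_pull (analyticAt_inputMap _ x) ?_ ?_ ?_
  -- Well-definedness. Gluing makes `Q j` a fixed vertex, and reducedness of `C(A)` puts the
  -- difference of `f j ∘ p` and the position of `Q j` in the ideal. The sum of the two relations is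
  -- the pull-back of `f_j - z_{β(j)}`.
  · have hmark : ∀ (j : J) k, GermMem (((A.selfFiberSum Q J β).analyticSpace Z).idealAt x)
        (fun z => coords z (glue A.mark Q J β (Q j), k) -
          if k = 0 then (Z (β j)).re else (Z (β j)).im) := by
      intro j k
      refine ((A.selfFiberSum Q J β).germMem_of_mem_schemeEqs Z x
        (Or.inr ⟨β j, k, rfl⟩)).congr (Eventually.of_forall fun z => ?_)
      rw [glue_out_eq]
      simp [markEq, selfFiberSum]
    have hQ : ∀ (j : J) k, AnalyticAt ℝ
        (fun w : V → ℂ => coords w (Q j, k)) (A.pullGlue Q J β x) :=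
      fun j k => analyticAt_coords _ _
    rintro _ ⟨j, rfl | rfl⟩ -
    · have h1 : GermMem ((A.analyticSpace Z).idealAt (A.pullGlue Q J β x))
          (fun w => (planeOf 𝕜 (f (inputMap 𝕜 P w) j)).re - coords w (Q j, 0)) := by
        refine hg.germMem _ ((analyticAt_re_planeOf hfp (j : Fin n)).1.sub (hQ j 0))
          (Eventually.of_forall fun w hw => ?_)
        rw [hpts] at hw
        rw [coords_zero, hout w hw, sub_self]
      refine ((A.germMem_pullGlue Z Q J β h1).add (hmark j 0)).congr
        (Eventually.of_forall fun z => ?_)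
      simp only [if_true, coords_pullGlue, Prod.map, id, Function.comp, hP, Complex.sub_re]
      ring
    · have h1 : GermMem ((A.analyticSpace Z).idealAt (A.pullGlue Q J β x))
          (fun w => (planeOf 𝕜 (f (inputMap 𝕜 P w) j)).im - coords w (Q j, 1)) := by
        refine hg.germMem _ ((analyticAt_re_planeOf hfp (j : Fin n)).2.sub (hQ j 1))
          (Eventually.of_forall fun w hw => ?_)
        rw [hpts] at hw
        rw [coords_one, hout w hw, sub_self]
      refine ((A.germMem_pullGlue Z Q J β h1).add (hmark j 1)).congr
        (Eventually.of_forall fun z => ?_)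
      simp only [one_ne_zero, if_false, coords_pullGlue, Prod.map, id, Function.comp, hP,
        Complex.sub_im]
      ring
  -- Surjectivity. On points of `C(A)` near the given one `g ∘ p` is the identity, and by
  -- reducedness also modulo the ideal. Hence `F ∘ restrictGlue ∘ g` is a preimage of `F`.
  · intro F hF
    have hFr : AnalyticAt ℝ (fun w => F (A.restrictGlue Q J β w)) (A.pullGlue Q J β x) :=
      AnalyticAt.fun_comp (by rwa [restrictGlue_pullGlue]) (A.analyticAt_restrictGlue Q J β _)
    have hu : AnalyticAt ℝ (fun y => F (A.restrictGlue Q J β (g y)))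
        (inputMap 𝕜 P (A.pullGlue Q J β x)) :=
      AnalyticAt.fun_comp (g := fun w => F (A.restrictGlue Q J β w))
        (by rwa [hg.apply_eq]) hg.analyticAt
    refine ⟨fun y => F (A.restrictGlue Q J β (g y)), hu, ?_⟩
    have h1 : GermMem ((A.analyticSpace Z).idealAt (A.pullGlue Q J β x))
        (fun w => F (A.restrictGlue Q J β (g (inputMap 𝕜 P w))) - F (A.restrictGlue Q J β w)) := by
      refine hg.germMem _ ((hu.fun_comp (analyticAt_inputMap P _)).sub hFr) ?_
      filter_upwards [hg.left_inv] with w hw hwX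
      rw [hw hwX, sub_self]
    refine (A.germMem_pullGlue Z Q J β h1).congr (Eventually.of_forall fun z => ?_)
    simp only [restrictGlue_pullGlue, hP]
  -- Injectivity. The relation is pulled back along `restrictGlue ∘ g`. This map need not land in
  -- the closed linkage: `g y` is compatible with the gluing only modulo the level ideal, as `hsec`
  -- records.
  · intro u hu hum
    have hsec := germMem_section_sub (D := D) (J := J) (β := β) hg hf' hout
    have hr : AnalyticAt ℝ (fun y => A.restrictGlue Q J β (g y))
        (inputMap 𝕜 (gluedInput A.mark Q J β P) x) :=
      (A.analyticAt_restrictGlue Q J β _).fun_comp hgx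
    have hrx : A.restrictGlue Q J β (g (inputMap 𝕜 (gluedInput A.mark Q J β P) x)) = x := by
      rw [hgx', restrictGlue_pullGlue]
    have hq : AnalyticAt ℝ (fun y => A.pullGlue Q J β (A.restrictGlue Q J β (g y)))
        (inputMap 𝕜 (gluedInput A.mark Q J β P) x) :=
      (A.analyticAt_pullGlue Q J β _).fun_comp hr
    have hqx : A.pullGlue Q J β (A.restrictGlue Q J β
        (g (inputMap 𝕜 (gluedInput A.mark Q J β P) x))) = A.pullGlue Q J β x := by
      rw [hrx]
    have h1 : GermMem ((levelSpace D f Z J β).idealAt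
        (inputMap 𝕜 (gluedInput A.mark Q J β P) x)) (fun y => u (inputMap 𝕜 (gluedInput A.mark Q J β P)
          (A.restrictGlue Q J β (g y)))) := by
      refine AnalyticModel.germMem_comp hr hrx ?_ hum
      rintro _ ⟨k, hk, rfl⟩ -
      rw [schemeEqs_selfFiberSum] at hk
      obtain ⟨k, hk, rfl⟩ := hk
      -- An equation of the closed linkage at `restrictGlue (g y)` is congruent, by Hadamard's
      -- lemma, to an equation of `A` at `g y`, where it vanishes.
      have h2 := GermMem.comp_sub_comp (analyticAt_eval_coords k (A.pullGlue Q J β x)) hq hgx hqx hgx'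
        (germMem_clm_sub hsec)
      refine h2.congr ?_
      have hmem := hg.mem_points
      filter_upwards [hmem] with y hy
      rw [eval_coords_pullGlue, hy.1.2 _ ⟨k, hk, rfl⟩, sub_zero]
      rfl
    have h3 : GermMem ((levelSpace D f Z J β).idealAt
        (inputMap 𝕜 (gluedInput A.mark Q J β P) x)) (fun y => u (inputMap 𝕜 (gluedInput A.mark Q J β P)
          (A.restrictGlue Q J β (g y))) - u y) := by
      refine GermMem.comp_sub_comp (s := fun y => y) hu ((analyticAt_inputMap _ _).fun_comp hr)
        analyticAt_id ?_ rfl fun l => ?_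
      · rw [hrx]
      · refine (germMem_clm_sub hsec (l.comp (inputCLM 𝕜 P))).congr ?_
        filter_upwards [hg.mem_points] with y hy
        have : inputCLM 𝕜 P (g y) = y := hy.2
        rw [ContinuousLinearMap.comp_apply, ContinuousLinearMap.comp_apply, this]
        rfl
    simpa using h1.sub h3

end StalkIso

end MarkedLinkage

/-! ### Quotients of Hausdorff spaces by finite groups -/

section FiniteGroup

variable {X Y : Type*} [TopologicalSpace X] [TopologicalSpace Y] {G : Subgroup (X ≃ₜ X)}

/-- If `g` moves `x`, disjoint neighbourhoods of `x` and `g x` give a neighbourhood of `x` that `g`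
moves off itself. Finitely many of these are intersected. -/
theorem exists_isOpen_forall_fixed [T2Space X] [Finite G] (x : X) :
    ∃ N, IsOpen N ∧ x ∈ N ∧ ∀ g ∈ G, ∀ y ∈ N, g y ∈ N → g x = x := by
  have h : ∀ g : G, ∃ N, IsOpen N ∧ x ∈ N ∧ ∀ y ∈ N, g.1 y ∈ N → g.1 x = x := by
    intro g
    by_cases hg : g.1 x = x
    · exact ⟨univ, isOpen_univ, mem_univ _, fun _ _ _ => hg⟩
    · obtain ⟨U, W, hU, hW, hxU, hxW, hd⟩ := t2_separation hg
      refine ⟨W ∩ g.1 ⁻¹' U, hW.inter (hU.preimage g.1.continuous), ⟨hxW, hxU⟩, fun y hy hy' => ?_⟩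
      exact (disjoint_left.1 hd hy.2 hy'.1).elim
  choose N hN hxN hfix using h
  refine ⟨⋂ g, N g, isOpen_iInter_of_finite hN, mem_iInter.2 hxN, fun g hg y hy hgy => ?_⟩
  exact hfix ⟨g, hg⟩ y (mem_iInter.1 hy _) (mem_iInter.1 hgy _)

theorem isClosed_wall [T2Space X] [Finite G] : IsClosed (wall G) := by
  have : wall G = ⋃ g : {g : G // g.1 ≠ 1}, {x | g.1.1 x = x} := by
    ext x
    simp only [wall, mem_ofPred_eq, mem_iUnion]
    exact ⟨fun ⟨g, hg, h1, h2⟩ => ⟨⟨⟨g, hg⟩, h1⟩, h2⟩, fun ⟨g, h2⟩ => ⟨g.1.1, g.1.2, g.2, h2⟩⟩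
  rw [this]
  exact isClosed_iUnion_of_finite fun g => isClosed_eq g.1.1.continuous continuous_id

theorem preimage_image_eq_iUnion {Y : Type*} {p : X → Y} (hp : ∀ x y, p x = p y ↔ ∃ g ∈ G, g x = y)
    (S : Set X) : p ⁻¹' (p '' S) = ⋃ g : G, g.1 ⁻¹' S := by
  ext x
  simp only [mem_preimage, mem_image, mem_iUnion]
  constructor
  · rintro ⟨y, hy, hxy⟩
    obtain ⟨g, hg, rfl⟩ := (hp x y).1 hxy.symm
    exact ⟨⟨g, hg⟩, hy⟩
  · rintro ⟨g, hg⟩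
    exact ⟨_, hg, ((hp _ _).2 ⟨g.1, g.2, rfl⟩).symm⟩

theorem Topology.IsQuotientMap.isOpenMap_of_fiber {p : X → Y} (hq : IsQuotientMap p)
    (hp : ∀ x y, p x = p y ↔ ∃ g ∈ G, g x = y) : IsOpenMap p := fun S hS => by
  rw [← hq.isOpen_preimage, preimage_image_eq_iUnion hp]
  exact isOpen_iUnion fun g => hS.preimage g.1.continuous

/-- The saturation of a closed set is a finite union of translates. Closed maps remain closed on
closed subspaces, which is how the quotient property passes to the closed linkage. -/
theorem Topology.IsQuotientMap.isClosedMap_of_fiber [Finite G] {p : X → Y} (hq : IsQuotientMap p)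
    (hp : ∀ x y, p x = p y ↔ ∃ g ∈ G, g x = y) : IsClosedMap p := fun S hS => by
  rw [← hq.isClosed_preimage, preimage_image_eq_iUnion hp]
  exact isClosed_iUnion_of_finite fun g => hS.preimage g.1.continuous

/-- The quotient of a Hausdorff space by a finite group is a regular ramified covering. -/
theorem isRegularRamifiedCovering_of_isQuotientMap [T2Space X] {p : X → Y} (hG : Finite G)
    (hq : IsQuotientMap p) (hp : ∀ x y, p x = p y ↔ ∃ g ∈ G, g x = y) :
    IsRegularRamifiedCovering G p := by
  refine ⟨hG, hq, hp, ?_⟩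
  let _ : MulAction G X :=
    { smul := fun g x => g.1 x
      one_smul := fun _ => rfl
      mul_smul := fun _ _ _ => rfl }
  have hsmul : ∀ (g : G) x, g • x = g.1 x := fun _ _ => rfl
  have : ContinuousConstSMul G X := ⟨fun g => g.1.continuous⟩
  have h := hq.isCoveringMapOn_of_smul_disjoint (G := G) (fun {x y} => ?_) fun x => ?_
  · refine h.mono (image_mono fun x hx => ?_)
    rw [mem_ofPred_eq, eq_bot_iff]
    intro g hg
    rw [Subgroup.mem_bot]
    by_contra hne
    exact hx ⟨g.1, g.2, fun h => hne (Subtype.ext h), hg⟩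
  · rw [eq_comm, hp]
    exact ⟨fun ⟨g, hg, h⟩ => ⟨⟨g, hg⟩, h⟩, fun ⟨g, h⟩ => ⟨g.1, g.2, h⟩⟩
  · obtain ⟨N, hN, hxN, hfix⟩ := exists_isOpen_forall_fixed (G := G) x
    refine ⟨N, hN.mem_nhds hxN, fun g => ?_⟩
    rintro ⟨_, ⟨y, hy, rfl⟩, hgy⟩
    exact hfix g.1 g.2 y hy hgy

end FiniteGroup

/-! ### Sheets of the covering over a free part of the quotient -/

section Sheets

variable {E F : Type*} [NormedAddCommGroup E] [NormedSpace ℝ E]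
  [NormedAddCommGroup F] [NormedSpace ℝ F]

/-- Over the quotient of a free orbit of a finite group, a map which is an isomorphism of local
rings is a locally analytically trivial covering. -/
theorem isLocallyAnalyticallyTrivialOver_of_isStalkIso {X : AnalyticModel E} {Y : AnalyticModel F}
    {h : E → F} {C : Set E} {G : Subgroup (C ≃ₜ C)} (hG : Finite G) (hC : X.points = C)
    (hh : Continuous h) (hopen : IsOpenMap fun x : C => (⟨h x, x, x.2, rfl⟩ : h '' C))
    (hfib : ∀ x y : C, h x = h y ↔ ∃ g ∈ G, g x = y)
    {D : Set F} (hD : IsOpen D) (hY : Y.points = h '' C ∩ D)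
    (hfree : ∀ x : C, h x ∈ D → ∀ g ∈ G, g x = x → g = 1)
    (hst : ∀ x : C, h x ∈ D → X.IsStalkIso Y h x) :
    IsLocallyAnalyticallyTrivialOver X Y h G := by
  subst hC
  intro y hy
  rw [hY] at hy
  obtain ⟨⟨x, hx, rfl⟩, hyD⟩ := hy
  obtain ⟨N, hN, hxN, hfix⟩ := exists_isOpen_forall_fixed (G := G) ⟨x, hx⟩
  obtain ⟨W, hW, hWN⟩ := isOpen_induced_iff.1 (hopen N hN)
  have hWN' : ∀ z : X.points, h z ∈ W ↔ ∃ w ∈ N, h w = h z := by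
    intro z
    have h1 := Set.ext_iff.1 hWN ⟨h z, z, z.2, rfl⟩
    rw [mem_preimage] at h1
    rw [h1]
    exact ⟨fun ⟨w, hw, hwz⟩ => ⟨w, hw, Subtype.ext_iff.1 hwz⟩,
      fun ⟨w, hw, hwz⟩ => ⟨w, hw, Subtype.ext hwz⟩⟩
  have hV : IsOpen (W ∩ D) := hW.inter hD
  have hinvG : ∀ σ : G, ∀ z : X.points, h (σ.1 z) = h z := fun σ z =>
    ((hfib z _).2 ⟨σ.1, σ.2, rfl⟩).symm
  -- The sheet of `σ` is the translate `σ N`, restricted to the part over `W ∩ D` and extended to an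
  -- open set of the ambient space.
  have hS : ∀ σ : G, ∃ S : Set E, IsOpen S ∧
      ∀ z : X.points, (z : E) ∈ S ↔ σ.1.symm z ∈ N ∧ h z ∈ W ∩ D := by
    intro σ
    have h1 : IsOpen {z : X.points | σ.1.symm z ∈ N ∧ h z ∈ W ∩ D} :=
      (hN.preimage σ.1.symm.continuous).inter (hV.preimage (hh.comp continuous_subtype_val))
    obtain ⟨S, hS, hS'⟩ := isOpen_induced_iff.1 h1
    exact ⟨S, hS, fun z => Set.ext_iff.1 hS' z⟩
  choose S hSo hSm using hS
  -- Freeness over `D` turns "fixes `x`" into "is trivial". Both injectivity on a sheet and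
  -- disjointness of the sheets rest on this.
  have hone : ∀ g ∈ G, ∀ z ∈ N, g z ∈ N → g = 1 := fun g hg z hz hgz =>
    hfree ⟨x, hx⟩ hyD g hg (hfix g hg z hz hgz)
  have hcov : ∀ z : X.points, h z ∈ W ∩ D → ∃ σ, (z : E) ∈ S σ := by
    intro z hz
    obtain ⟨w, hw, hwz⟩ := (hWN' z).1 hz.1
    obtain ⟨g, hg, rfl⟩ := (hfib w z).1 hwz
    exact ⟨⟨g, hg⟩, (hSm _ _).2 ⟨by rwa [g.symm_apply_apply], hz⟩⟩
  refine ⟨W ∩ D, hV, ⟨(hWN' ⟨x, hx⟩).2 ⟨_, hxN, rfl⟩, hyD⟩, S, ?_, ?_, ?_, ?_⟩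
  · intro σ
    refine ⟨hSo σ, hV, ?_, fun z hz => hst ⟨z, hz.1⟩ ((hSm σ ⟨z, hz.1⟩).1 hz.2).2.2⟩
    let e : ↥(X.points ∩ S σ) → ↥(Y.points ∩ (W ∩ D)) := fun z =>
      ⟨h z, by
        have := ((hSm σ ⟨z, z.2.1⟩).1 z.2.2).2
        exact ⟨hY ▸ ⟨⟨z, z.2.1, rfl⟩, this.2⟩, this⟩⟩
    have hec : Continuous e := (hh.comp continuous_subtype_val).subtype_mk _
    have hinj : Function.Injective e := by
      intro z w hzw
      have h0 : h z = h w := congrArg Subtype.val hzw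
      obtain ⟨g, hg, hgz⟩ := (hfib ⟨z, z.2.1⟩ ⟨w, w.2.1⟩).1 h0
      have h1 := ((hSm σ ⟨z, z.2.1⟩).1 z.2.2).1
      have h2 := ((hSm σ ⟨w, w.2.1⟩).1 w.2.2).1
      -- Moving both points back to `N` by `σ⁻¹` turns `g` into its conjugate.
      have h3 := hone (σ.1⁻¹ * g * σ.1) (G.mul_mem (G.mul_mem (G.inv_mem σ.2) hg) σ.2) _ h1 (by
        rw [Homeomorph.mul_apply, Homeomorph.mul_apply, σ.1.apply_symm_apply, hgz]
        exact h2)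
      have h4 : g = 1 := by
        have := congrArg (fun k => σ.1 * k * σ.1⁻¹) h3
        simpa [mul_assoc] using this
      rw [h4] at hgz
      have h5 : (⟨z, z.2.1⟩ : X.points) = ⟨w, w.2.1⟩ := hgz
      exact Subtype.ext (Subtype.mk.inj h5)
    have hsurj : Function.Surjective e := by
      rintro ⟨y, hyY, hyV⟩
      rw [hY] at hyY
      obtain ⟨⟨z, hz, rfl⟩, -⟩ := hyY
      obtain ⟨τ, hτ⟩ := hcov ⟨z, hz⟩ hyV
      have h1 := (hSm τ ⟨z, hz⟩).1 hτ
      -- A preimage found in the sheet of `τ` is moved to the sheet of `σ` by `σ τ⁻¹`, without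
      -- changing its image.
      have h3 : h (σ.1 (τ.1.symm ⟨z, hz⟩)) = h z := by
        rw [hinvG σ]
        exact hinvG τ⁻¹ _
      refine ⟨⟨σ.1 (τ.1.symm ⟨z, hz⟩), (σ.1 _).2, (hSm σ _).2 ⟨?_, ?_⟩⟩, Subtype.ext h3⟩
      · rw [σ.1.symm_apply_apply]
        exact h1.1
      · rwa [h3]
    have heo : IsOpenMap e := by
      intro T hT
      obtain ⟨T', hT', rfl⟩ := isOpen_induced_iff.1 hT
      obtain ⟨R, hR, hR'⟩ := isOpen_induced_iff.1
        (hopen (Subtype.val ⁻¹' (T' ∩ S σ)) ((hT'.inter (hSo σ)).preimage continuous_subtype_val))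
      refine isOpen_induced_iff.2 ⟨R, hR, ?_⟩
      ext ⟨y, hyY, hyV⟩
      have hyY' := hyY
      rw [hY] at hyY'
      have h1 := Set.ext_iff.1 hR' ⟨y, hyY'.1⟩
      rw [mem_preimage] at h1 ⊢
      rw [h1]
      constructor
      · rintro ⟨z, hz, hzy⟩
        have h2 : h z = y := Subtype.ext_iff.1 hzy
        exact ⟨⟨z, z.2, hz.2⟩, hz.1, Subtype.ext h2⟩
      · rintro ⟨z, hz, hzy⟩
        have h2 : h z = y := Subtype.ext_iff.1 hzy
        exact ⟨⟨z, z.2.1⟩, ⟨hz, z.2.2⟩, Subtype.ext h2⟩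
    exact ⟨(Equiv.ofBijective e ⟨hinj, hsurj⟩).toHomeomorphOfContinuousOpen hec heo,
      fun _ => rfl⟩
  · ext z
    simp only [mem_inter_iff, mem_preimage, mem_iUnion, and_congr_right_iff]
    intro hz
    exact ⟨fun hzV => hcov ⟨z, hz⟩ hzV, fun ⟨σ, hσ⟩ => ((hSm σ ⟨z, hz⟩).1 hσ).2⟩
  · intro σ τ hστ
    rw [eq_empty_iff_forall_notMem]
    rintro z ⟨⟨hz, hσ⟩, hτ⟩
    have h1 := ((hSm σ ⟨z, hz⟩).1 hσ).1
    have h2 := ((hSm τ ⟨z, hz⟩).1 hτ).1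
    have h3 := hone (τ.1⁻¹ * σ.1) (G.mul_mem (G.inv_mem τ.2) σ.2) _ h1 (by
      rw [Homeomorph.mul_apply, σ.1.apply_symm_apply]
      exact h2)
    exact hστ (Subtype.ext (inv_mul_eq_one.1 h3).symm)
  · intro σ τ φ hφ
    have h1 := (hSm τ φ).1 hφ
    refine (hSm (σ * τ) _).2 ⟨?_, by rw [hinvG]; exact h1.2⟩
    have : (σ * τ).1.symm (σ.1 φ) = τ.1.symm φ := by
      rw [Homeomorph.symm_apply_eq, Subgroup.coe_mul, Homeomorph.mul_apply, τ.1.apply_symm_apply]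
    rw [this]
    exact h1.1

end Sheets

/-! ### Functional linkages over `Dom*` -/

section FunctionalLinkage

variable {𝕜 : Type*} [RCLike 𝕜] {V E : Type*} [Fintype V] {s m n : ℕ}
  {A : MarkedLinkage V E s} {Z : Fin s → ℂ} {P : Fin m → V} {Q : Fin n → V}
  {Sym : Subgroup (A.config Z ≃ₜ A.config Z)}
  {f : (Fin m → 𝕜) → (Fin n → 𝕜)} {O : Fin m → 𝕜}

theorem exists_isAnalyticSection_of_mem_configStar [Finite E] {φ : V → ℂ} (hφ : φ ∈ configStar 𝕜 A Z P) :
    ∃ g, (A.analyticSpace Z).IsAnalyticSection (inputMap 𝕜 P) φ g :=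
  hφ.2.exists_isAnalyticSection (by rw [A.points_analyticSpace]; exact hφ.1)

/-- The open sets witnessing a local isomorphism at `φ` also witness it at nearby points, and the
analytic section supplies such a point over every input near that of `φ`. -/
theorem isOpen_domStar [Finite E] : IsOpen (domStar 𝕜 A Z P) := by
  rw [isOpen_iff_mem_nhds]
  rintro _ ⟨φ, hφ, rfl⟩
  obtain ⟨g, hg⟩ := exists_isAnalyticSection_of_mem_configStar hφ
  obtain ⟨U, W, hU, -, hiso⟩ := hφ.2
  have hgt : Tendsto g (𝓝 (inputMap 𝕜 P φ)) (𝓝 φ) := by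
    have := hg.analyticAt.continuousAt
    rwa [ContinuousAt, hg.apply_eq] at this
  filter_upwards [hg.mem_points, hgt.eventually (hiso.1.mem_nhds hU)] with y hy hyU
  obtain ⟨e, he⟩ := hiso.2.2.1
  have hW : inputMap 𝕜 P (g y) ∈ W := by
    rw [← he ⟨g y, hy.1, hyU⟩]
    exact (e _).2.2
  refine ⟨g y, ⟨?_, U, W, hyU, hW, hiso⟩, hy.2⟩
  rw [← A.points_analyticSpace]
  exact hy.1

namespace IsFunctionalLinkage

theorem inputMap_eq_iff (hA : IsFunctionalLinkage A Z P Q Sym f O) (φ ψ : A.config Z) :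
    inputMap 𝕜 P φ = inputMap 𝕜 P ψ ↔ ∃ σ ∈ Sym, σ φ = ψ := by
  rw [← hA.covering.fiber]
  exact ⟨fun h => Subtype.ext h, fun h => Subtype.ext_iff.1 h⟩

/-- By definition only some point of the fibre lies in `C*`. The group `Sym` is transitive on the
fibre and consists of scheme automorphisms, so the section is transported to every point. -/
theorem exists_isAnalyticSection [Finite E] (hA : IsFunctionalLinkage A Z P Q Sym f O) (φ : A.config Z)
    (hφ : inputMap 𝕜 P φ ∈ domStar 𝕜 A Z P) :
    ∃ g, (A.analyticSpace Z).IsAnalyticSection (inputMap 𝕜 P) φ g := by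
  obtain ⟨ψ, hψ, hψφ⟩ := hφ
  obtain ⟨σ, hσ, rfl⟩ := (hA.inputMap_eq_iff ⟨ψ, hψ.1⟩ φ).1 hψφ
  exact (hA.schemeAutomorphism σ hσ).exists_isAnalyticSection
    (fun χ => ((hA.inputMap_eq_iff χ _).2 ⟨σ, hσ, rfl⟩).symm)
    (exists_isAnalyticSection_of_mem_configStar hψ)

/-- The symmetry group acts freely over `Dom*`. -/
theorem eq_one_of_fixed [Finite E] (hA : IsFunctionalLinkage A Z P Q Sym f O) {φ : A.config Z}
    (hφ : inputMap 𝕜 P φ ∈ domStar 𝕜 A Z P) {σ : A.config Z ≃ₜ A.config Z} (hσ : σ ∈ Sym)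
    (hfix : σ φ = φ) : σ = 1 := by
  by_contra hne
  obtain ⟨g, hg⟩ := hA.exists_isAnalyticSection φ hφ
  have h1 : ∀ᶠ ψ : A.config Z in 𝓝 φ, g (inputMap 𝕜 P ψ) = ψ := by
    filter_upwards [continuous_subtype_val.continuousAt.eventually hg.left_inv] with ψ hψ
    exact hψ (by rw [A.points_analyticSpace]; exact ψ.2)
  have hσt : Tendsto σ (𝓝 φ) (𝓝 φ) := by
    have := σ.continuous.tendsto φ
    rwa [hfix] at this
  -- The symmetry `σ` preserves the input, which determines the realization near `φ`. So `σ` is the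
  -- identity near `φ`, against the nowhere density of the wall.
  have h2 : wall Sym ∈ 𝓝 φ := by
    filter_upwards [h1, hσt.eventually h1] with ψ h h'
    refine ⟨σ, hσ, hne, Subtype.ext ?_⟩
    rw [← h', ← (hA.inputMap_eq_iff ψ (σ ψ)).2 ⟨σ, hσ, rfl⟩, h]
  have h3 : φ ∈ interior (closure (wall Sym)) :=
    interior_mono subset_closure (mem_interior_iff_mem_nhds.2 h2)
  rw [hA.wall_nowhereDense] at h3
  exact h3

/-- Locally `f` is the position of the output vertices along an analytic section of the input map.
-/
theorem analyticOnNhd [Finite E] (hA : IsFunctionalLinkage A Z P Q Sym f O) :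
    AnalyticOnNhd ℝ f (domStar 𝕜 A Z P) := by
  rintro _ ⟨φ, hφ, rfl⟩
  obtain ⟨g, hg⟩ := exists_isAnalyticSection_of_mem_configStar hφ
  refine ((analyticAt_inputMap (𝕜 := 𝕜) Q _).fun_comp hg.analyticAt).congr ?_
  filter_upwards [hg.mem_points] with y hy
  funext j
  rw [A.points_analyticSpace] at hy
  rw [inputMap, hA.output _ hy.1, hy.2, ofPlane_planeOf]

end IsFunctionalLinkage

end FunctionalLinkage

/-! ### The closed embedding of the glued configuration space -/

namespace MarkedLinkage

section Unglue

variable {V E : Type*} {s n : ℕ} (A : MarkedLinkage V E s) (Z : Fin s → ℂ) (Q : Fin n → V)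
  (J : Set (Fin n)) (β : J → Fin s)

theorem unglue_injective : Function.Injective (A.unglue Z Q J β) := fun φ ψ h => by
  have h1 : A.pullGlue Q J β φ = A.pullGlue Q J β ψ := congrArg Subtype.val h
  have h2 := congrArg (A.restrictGlue Q J β) h1
  rw [restrictGlue_pullGlue, restrictGlue_pullGlue] at h2
  exact Subtype.ext h2

theorem continuous_unglue : Continuous (A.unglue Z Q J β) :=
  continuous_induced_rng.2 (continuous_pi fun v =>
    (continuous_apply (glue A.mark Q J β v)).comp continuous_subtype_val)

theorem isEmbedding_unglue : IsEmbedding (A.unglue Z Q J β) := by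
  have hr : Continuous fun φ : A.config Z => A.restrictGlue Q J β φ :=
    continuous_pi fun _ => (continuous_apply _).comp continuous_subtype_val
  refine .of_comp (A.continuous_unglue Z Q J β) hr ?_
  have : (fun φ : A.config Z => A.restrictGlue Q J β φ) ∘ A.unglue Z Q J β = Subtype.val :=
    funext fun φ => A.restrictGlue_pullGlue Q J β φ
  rw [this]
  exact IsEmbedding.subtypeVal

/-- The realizations of the closed linkage are those realizations of `A` that send the chosen output
vertices to the chosen fixed points. -/
theorem mem_range_unglue_iff (φ : A.config Z) :
    φ ∈ range (A.unglue Z Q J β) ↔ ∀ j : J, (φ : V → ℂ) (Q j) = Z (β j) := by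
  constructor
  · rintro ⟨ψ, rfl⟩ j
    change ψ.1 (glue A.mark Q J β (Q j)) = _
    rw [glue_out_eq]
    exact ψ.2.2 (β j)
  · intro h
    have hcongr : ∀ a b : V, (∃ j : J, a = Q j ∧ b = A.mark (β j)) →
        (φ : V → ℂ) a = (φ : V → ℂ) b := by
      rintro _ _ ⟨j, rfl, rfl⟩
      rw [h, φ.2.2]
    exact ⟨⟨Quot.lift φ.1 hcongr, fun e => φ.2.1 e, fun i => φ.2.2 i⟩, Subtype.ext rfl⟩

theorem isClosedEmbedding_unglue : IsClosedEmbedding (A.unglue Z Q J β) := by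
  refine ⟨A.isEmbedding_unglue Z Q J β, ?_⟩
  have : range (A.unglue Z Q J β) = 
      ⋂ j : J, {φ : A.config Z | (φ : V → ℂ) (Q j) = Z (β j)} := by
    ext φ
    rw [mem_range_unglue_iff, mem_iInter]
    rfl
  rw [this]
  exact isClosed_iInter fun j =>
    isClosed_eq ((continuous_apply _).comp continuous_subtype_val) continuous_const

end Unglue

end MarkedLinkage

/-! ### Symmetries, quotient and domain of the closed linkage -/

section ClosedLinkage

open MarkedLinkage

variable {𝕜 : Type*} [RCLike 𝕜] {V E : Type*} [Fintype V] {s m n : ℕ}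
  {A : MarkedLinkage V E s} {Z : Fin s → ℂ} {P : Fin m → V} {Q : Fin n → V}
  {Sym : Subgroup (A.config Z ≃ₜ A.config Z)}
  {f : (Fin m → 𝕜) → (Fin n → 𝕜)} {O : Fin m → 𝕜} {J : Set (Fin n)} {β : J → Fin s}

/-- A loop would have to realize its positive length as the distance of a point from itself. -/
theorem MarkedLinkage.Loopless.of_nonempty_config {V E : Type*} {L : MarkedLinkage V E s}
    (h : (L.config Z).Nonempty) : L.Loopless := by
  obtain ⟨φ, hφ⟩ := h
  intro e he
  have h1 := hφ.1 e
  rw [he, sub_self, norm_zero, zero_pow two_ne_zero] at h1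
  exact (pow_pos (L.len_pos e) 2).ne h1

namespace IsFunctionalLinkage

/-- The closing condition depends on a realization only through `f` of its input, and symmetries
preserve the input. -/
theorem map_mem_range_unglue (hA : IsFunctionalLinkage A Z P Q Sym f O)
    {σ : A.config Z ≃ₜ A.config Z} (hσ : σ ∈ Sym) {φ : A.config Z}
    (hφ : φ ∈ range (A.unglue Z Q J β)) : σ φ ∈ range (A.unglue Z Q J β) := by
  rw [mem_range_unglue_iff] at hφ ⊢
  intro j
  rw [← hφ j, hA.output _ φ.2, hA.output _ (σ φ).2, (hA.inputMap_eq_iff φ _).2 ⟨σ, hσ, rfl⟩]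

/-- Symmetries of `A` restrict to the configuration space of the closed linkage. -/
theorem exists_restrict (hA : IsFunctionalLinkage A Z P Q Sym f O)
    {σ : A.config Z ≃ₜ A.config Z} (hσ : σ ∈ Sym) :
    ∃ h : (A.selfFiberSum Q J β).config Z ≃ₜ (A.selfFiberSum Q J β).config Z,
      ∀ φ, A.unglue Z Q J β (h φ) = σ (A.unglue Z Q J β φ) := by
  have hmap : ∀ τ ∈ Sym, ∃ k : (A.selfFiberSum Q J β).config Z → (A.selfFiberSum Q J β).config Z,
      Continuous k ∧ ∀ φ, A.unglue Z Q J β (k φ) = τ (A.unglue Z Q J β φ) := by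
    intro τ hτ
    choose k hk using fun φ : (A.selfFiberSum Q J β).config Z =>
      hA.map_mem_range_unglue hτ (mem_range_self (f := A.unglue Z Q J β) φ)
    refine ⟨k, (A.isEmbedding_unglue Z Q J β).continuous_iff.2 ?_, hk⟩
    have : A.unglue Z Q J β ∘ k = τ ∘ A.unglue Z Q J β := funext hk
    rw [this]
    exact τ.continuous.comp (A.continuous_unglue Z Q J β)
  obtain ⟨k, hkc, hk⟩ := hmap σ hσ
  obtain ⟨l, hlc, hl⟩ := hmap σ⁻¹ (Sym.inv_mem hσ)
  refine ⟨⟨⟨k, l, fun φ => ?_, fun φ => ?_⟩, hkc, hlc⟩, hk⟩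
  · apply A.unglue_injective
    rw [hl, hk]
    exact σ.symm_apply_apply _
  · apply A.unglue_injective
    rw [hk, hl]
    exact σ.apply_symm_apply _

/-- Restriction identifies the symmetry group of `A` with that of the closed linkage. -/
theorem exists_closedSym_mulEquiv [Finite E] (hA : IsFunctionalLinkage A Z P Q Sym f O)
    (hne : (inputDom 𝕜 (A.selfFiberSum Q J β) Z (gluedInput A.mark Q J β P) ∩
      domStar 𝕜 A Z P).Nonempty) :
    ∃ e : Sym ≃* A.closedSym Z Q J β Sym, ∀ (σ : Sym) φ,
      A.unglue Z Q J β ((e σ).1 φ) = σ.1 (A.unglue Z Q J β φ) := by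
  choose r hr using fun σ : Sym => hA.exists_restrict (J := J) (β := β) σ.2
  have hext : ∀ h k : (A.selfFiberSum Q J β).config Z ≃ₜ (A.selfFiberSum Q J β).config Z,
      (∀ φ, A.unglue Z Q J β (h φ) = A.unglue Z Q J β (k φ)) → h = k := fun h k hhk =>
    Homeomorph.ext fun φ => A.unglue_injective Z Q J β (hhk φ)
  let e : Sym →* A.closedSym Z Q J β Sym :=
    { toFun := fun σ => ⟨r σ, σ.1, σ.2, hr σ⟩
      map_one' := Subtype.ext (hext _ _ fun φ => by rw [hr]; rfl)
      map_mul' := fun σ τ => Subtype.ext (hext _ _ fun φ => by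
        rw [hr, Subgroup.coe_mul, Homeomorph.mul_apply]
        change _ = A.unglue Z Q J β (r σ (r τ φ))
        rw [hr, hr]) }
  refine ⟨MulEquiv.ofBijective e ⟨?_, ?_⟩, fun σ φ => hr σ φ⟩
  · rw [injective_iff_map_eq_one]
    intro σ hσ
    -- A symmetry that restricts to the identity fixes this point over `Dom*(A)`, where the action
    -- is free.
    obtain ⟨_, ⟨φ, hφ, rfl⟩, hx⟩ := hne
    have h1 : r σ = 1 := congrArg Subtype.val hσ
    refine Subtype.ext (hA.eq_one_of_fixed (φ := A.unglue Z Q J β ⟨φ, hφ⟩) hx σ.2 ?_)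
    rw [← hr, h1]
    rfl
  · rintro ⟨h, σ, hσ, hh⟩
    exact ⟨⟨σ, hσ⟩, Subtype.ext (hext _ _ fun φ => by rw [hh]; exact hr _ φ)⟩

theorem inputMap_closed_eq_iff (hA : IsFunctionalLinkage A Z P Q Sym f O)
    (φ ψ : (A.selfFiberSum Q J β).config Z) :
    inputMap 𝕜 (gluedInput A.mark Q J β P) φ = inputMap 𝕜 (gluedInput A.mark Q J β P) ψ ↔
      ∃ h ∈ A.closedSym Z Q J β Sym, h φ = ψ := by
  refine (hA.inputMap_eq_iff (A.unglue Z Q J β φ) (A.unglue Z Q J β ψ)).trans ?_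
  constructor
  · rintro ⟨σ, hσ, h⟩
    obtain ⟨k, hk⟩ := hA.exists_restrict (J := J) (β := β) hσ
    exact ⟨k, ⟨σ, hσ, hk⟩, A.unglue_injective Z Q J β ((hk φ).trans h)⟩
  · rintro ⟨k, ⟨σ, hσ, hk⟩, rfl⟩
    exact ⟨σ, hσ, (hk φ).symm⟩

theorem closed_eq_one_of_fixed [Finite E] (hA : IsFunctionalLinkage A Z P Q Sym f O)
    {φ : (A.selfFiberSum Q J β).config Z}
    (hφ : inputMap 𝕜 (gluedInput A.mark Q J β P) φ ∈ domStar 𝕜 A Z P)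
    {h : (A.selfFiberSum Q J β).config Z ≃ₜ (A.selfFiberSum Q J β).config Z}
    (hh : h ∈ A.closedSym Z Q J β Sym) (hfix : h φ = φ) : h = 1 := by
  obtain ⟨σ, hσ, hσh⟩ := hh
  have h1 : σ = 1 := hA.eq_one_of_fixed (φ := A.unglue Z Q J β φ) hφ hσ (by rw [← hσh, hfix])
  refine Homeomorph.ext fun ψ => A.unglue_injective Z Q J β ?_
  rw [hσh, h1]
  rfl

theorem isQuotientMap_closed (hA : IsFunctionalLinkage A Z P Q Sym f O) :
    IsQuotientMap (inputToDom 𝕜 (A.selfFiberSum Q J β) Z (gluedInput A.mark Q J β P)) := by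
  have := hA.covering.finite
  have hcl : IsClosedMap (inputToDom 𝕜 A Z P) :=
    hA.covering.quotient.isClosedMap_of_fiber hA.covering.fiber
  have hsub : inputDom 𝕜 (A.selfFiberSum Q J β) Z (gluedInput A.mark Q J β P) ⊆
      inputDom 𝕜 A Z P := by
    rintro _ ⟨φ, hφ, rfl⟩
    exact ⟨_, (A.unglue Z Q J β ⟨φ, hφ⟩).2, rfl⟩
  refine IsClosedMap.isQuotientMap (fun S hS => ?_) ?_ ?_
  · have h1 := (hcl _ ((A.isClosedEmbedding_unglue Z Q J β).isClosedMap S hS)).preimage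
      (continuous_inclusion hsub)
    convert h1 using 1
    ext ⟨y, hy⟩
    simp only [mem_image, mem_preimage, exists_exists_and_eq_and]
    constructor
    · rintro ⟨φ, hφ, h⟩
      have h' : inputMap 𝕜 P (A.unglue Z Q J β φ) = y := Subtype.ext_iff.1 h
      exact ⟨φ, hφ, Subtype.ext h'⟩
    · rintro ⟨φ, hφ, h⟩
      have h' : inputMap 𝕜 (gluedInput A.mark Q J β P) φ = y := Subtype.ext_iff.1 h
      exact ⟨φ, hφ, Subtype.ext h'⟩
  · exact ((continuous_inputMap _).comp continuous_subtype_val).subtype_mk _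
  · rintro ⟨_, φ, hφ, rfl⟩
    exact ⟨⟨φ, hφ⟩, rfl⟩

theorem closed_fiber (hA : IsFunctionalLinkage A Z P Q Sym f O)
    (φ ψ : (A.selfFiberSum Q J β).config Z) :
    inputToDom 𝕜 (A.selfFiberSum Q J β) Z (gluedInput A.mark Q J β P) φ =
      inputToDom 𝕜 (A.selfFiberSum Q J β) Z (gluedInput A.mark Q J β P) ψ ↔
      ∃ h ∈ A.closedSym Z Q J β Sym, h φ = ψ := by
  rw [← hA.inputMap_closed_eq_iff]
  exact ⟨fun h => Subtype.ext_iff.1 h, fun h => Subtype.ext h⟩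

/-- `Dom*(L)` is the level set of `f` in `Dom*(A)`. -/
theorem inputDom_inter_domStar (hA : IsFunctionalLinkage A Z P Q Sym f O) :
    inputDom 𝕜 (A.selfFiberSum Q J β) Z (gluedInput A.mark Q J β P) ∩ domStar 𝕜 A Z P =
      {x ∈ domStar 𝕜 A Z P | ∀ j : J, planeOf 𝕜 (f x j) = Z (β j)} := by
  ext x
  constructor
  · rintro ⟨⟨φ, hφ, rfl⟩, hx⟩
    refine ⟨hx, fun j => ?_⟩
    have h1 := (A.mem_range_unglue_iff Z Q J β _).1
      (mem_range_self (f := A.unglue Z Q J β) ⟨φ, hφ⟩) j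
    rw [← h1, hA.output _ (A.unglue Z Q J β ⟨φ, hφ⟩).2]
    rfl
  · rintro ⟨hx, hxJ⟩
    refine ⟨?_, hx⟩
    obtain ⟨φ, hφ, rfl⟩ := hx
    have h1 : (⟨φ, hφ.1⟩ : A.config Z) ∈ range (A.unglue Z Q J β) := by
      rw [mem_range_unglue_iff]
      intro j
      rw [← hxJ j]
      exact hA.output φ hφ.1 j
    obtain ⟨ψ, hψ⟩ := h1
    refine ⟨ψ, ψ.2, ?_⟩
    change inputMap 𝕜 P (A.unglue Z Q J β ψ) = _
    rw [hψ]

end IsFunctionalLinkage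

theorem levelSpace_points (D : Set (Fin m → 𝕜)) :
    (levelSpace D f Z J β).points = {x ∈ D | ∀ j : J, planeOf 𝕜 (f x j) = Z (β j)} := by
  ext x
  refine and_congr_right fun _ => ⟨fun h j => sub_eq_zero.1 (Complex.ext ?_ ?_), ?_⟩
  · exact h _ ⟨j, Or.inl rfl⟩
  · exact h _ ⟨j, Or.inr rfl⟩
  · rintro h _ ⟨j, rfl | rfl⟩
    · simp [h j]
    · simp [h j]

end ClosedLinkage

theorem mainTheorem9 {𝕜 : Type*} [RCLike 𝕜] {V E : Type*} [Fintype V] [Finite E] {s m n : ℕ}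
    (A : MarkedLinkage V E s) (Z : Fin s → ℂ) (P : Fin m → V) (Q : Fin n → V)
    (Sym : Subgroup (A.config Z ≃ₜ A.config Z))
    (f : (Fin m → 𝕜) → (Fin n → 𝕜)) (O : Fin m → 𝕜)
    (hA : IsFunctionalLinkage A Z P Q Sym f O)
    (J : Set (Fin n)) (β : J → Fin s)
    (hne : (inputDom 𝕜 (A.selfFiberSum Q J β) Z (gluedInput A.mark Q J β P) ∩
      domStar 𝕜 A Z P).Nonempty) :
    let L := A.selfFiberSum Q J β
    let P' := gluedInput A.mark Q J β P
    let SymL := A.closedSym Z Q J β Sym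
    let domStarL := inputDom 𝕜 L Z P' ∩ domStar 𝕜 A Z P
    L.Loopless ∧
    -- restriction identifies the symmetry group of `A` with that of `L`
    (∃ e : Sym ≃* SymL, ∀ (σ : Sym) (φ : L.config Z),
      A.unglue Z Q J β ((e σ).1 φ) = σ.1 (A.unglue Z Q J β φ)) ∧
    IsRegularRamifiedCovering SymL (inputToDom 𝕜 L Z P') ∧
    -- the ramification is nowhere dense as soon as `Dom*(L)` is dense in `Dom(L)`
    (Dense {x : inputDom 𝕜 L Z P' | (x : Fin m → 𝕜) ∈ domStarL} → IsNowhereDense (wall SymL)) ∧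
    -- the level set of `f` in `Dom*(A)` is an analytic space
    IsOpen (domStar 𝕜 A Z P) ∧ AnalyticOnNhd ℝ f (domStar 𝕜 A Z P) ∧
    -- `Dom*(L)` is open in `Dom(L)`
    IsOpen {x : inputDom 𝕜 L Z P' | (x : Fin m → 𝕜) ∈ domStarL} ∧
    -- `Dom*(L)` is the level set of `f` in `Dom*(A)`, in particular isomorphic to it
    domStarL = {x ∈ domStar 𝕜 A Z P | ∀ j : J, planeOf 𝕜 (f x j) = Z (β j)} ∧
    AnalyticallyIsomorphic domStarL
      {x ∈ domStar 𝕜 A Z P | ∀ j : J, planeOf 𝕜 (f x j) = Z (β j)} ∧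
    -- over `Dom*(L)` the covering is locally analytically trivial, in the scheme-theoretic sense
    IsLocallyAnalyticallyTrivialOver (L.analyticSpace Z)
      (levelSpace (domStar 𝕜 A Z P) f Z J β) (inputMap 𝕜 P') SymL := by
  intro L P' SymL domStarL
  obtain ⟨e, he⟩ := hA.exists_closedSym_mulEquiv hne
  have hfin : Finite SymL := by
    have := hA.covering.finite
    exact Finite.of_equiv _ e.toEquiv
  have hq : IsQuotientMap (inputToDom 𝕜 L Z P') := hA.isQuotientMap_closed
  have hfib : ∀ φ ψ, inputToDom 𝕜 L Z P' φ = inputToDom 𝕜 L Z P' ψ ↔ ∃ h ∈ SymL, h φ = ψ :=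
    hA.closed_fiber
  have hopen : IsOpenMap (inputToDom 𝕜 L Z P') := hq.isOpenMap_of_fiber hfib
  have hdom : domStarL = {x ∈ domStar 𝕜 A Z P | ∀ j : J, planeOf 𝕜 (f x j) = Z (β j)} :=
    hA.inputDom_inter_domStar
  refine ⟨?_, ⟨e, he⟩, isRegularRamifiedCovering_of_isQuotientMap hfin hq hfib, ?_,
    isOpen_domStar, hA.analyticOnNhd, ?_, hdom, ?_, ?_⟩
  · obtain ⟨_, ⟨φ, hφ, -⟩, -⟩ := hne
    exact .of_nonempty_config ⟨φ, hφ⟩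
  · intro hdense
    rw [IsNowhereDense, (isClosed_wall (G := SymL)).closure_eq, eq_empty_iff_forall_notMem]
    intro φ hφ
    -- The wall is closed, so it suffices that its interior is empty. The input map is open, hence
    -- the image of a nonempty interior would meet the dense set `Dom*(L)`, over which no nontrivial
    -- symmetry has a fixed point.
    obtain ⟨_, ⟨ψ, hψ, rfl⟩, hψ'⟩ := hdense.inter_open_nonempty _
      (hopen _ isOpen_interior) ⟨_, mem_image_of_mem _ hφ⟩
    obtain ⟨h, hh, hne1, hfix⟩ := interior_subset hψ
    exact hne1 (hA.closed_eq_one_of_fixed hψ'.2 hh hfix)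
  · have : {x : inputDom 𝕜 L Z P' | (x : Fin m → 𝕜) ∈ domStarL} =
        Subtype.val ⁻¹' domStar 𝕜 A Z P := by
      ext x
      exact ⟨fun h => h.2, fun h => ⟨x.2, h⟩⟩
    rw [this]
    exact isOpen_domStar.preimage continuous_subtype_val
  · rw [hdom]
    exact ⟨Equiv.refl _, fun _ => ⟨id, analyticAt_id, Eventually.of_forall fun _ => rfl⟩,
      fun _ => ⟨id, analyticAt_id, Eventually.of_forall fun _ => rfl⟩⟩
  · refine isLocallyAnalyticallyTrivialOver_of_isStalkIso hfin (L.points_analyticSpace Z)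
      (continuous_inputMap P') hopen hA.inputMap_closed_eq_iff
      (isOpen_domStar (A := A) (Z := Z) (P := P)) ?_ ?_ ?_
    · rw [levelSpace_points, ← hdom]
      rfl
    · exact fun φ hφ h hh hfix => hA.closed_eq_one_of_fixed hφ hh hfix
    · intro φ hφ
      obtain ⟨g, hg⟩ := hA.exists_isAnalyticSection (A.unglue Z Q J β φ) hφ
      exact MarkedLinkage.isStalkIso_selfFiberSum hg (hA.analyticOnNhd _ hφ) hA.output

end
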